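/- **Setting.** Let $\mathcal C$, $S$, $A$ be finite sets of contexts, states and actions and $H$ a horizon. For every context $c$ there is an MDP with dynamics $P^c_\star(\cdot\mid s,a)$, and reward distributions on $[0,1]$ with means $r^c_\star(s,a)$. The dynamics is layered: for each $c$, $S$ is partitioned into layers $S^c_0=\{s_0\},S^c_1,\dots,S^c_H=\{s_H\}$, and transitions lead from $S^c_h$ to $S^c_{h+1}$ only. Episodes start in $s_0$ and last $H$ steps; no reward is collected in $s_H$. For a policy $\pi:S\to A$ let $q_h(s\mid\pi,P)$ be the probability of being in $s$ at time $h$, $q(s\mid\pi,P)$ the probability of visiting $s$, and $V^\pi_{P,r}=\mathbb E\big[\sum_{h=0}^{H-1} r(s_h,\pi(s_h))\big]$. Assume minimum reachability: for some $p_{\min}\in(0,1]$, $q_h(s\mid\pi,P^c_\star)\ge p_{\min}$ for all $c$, $h<H$, $s\in S^c_h$ and $\pi:S\to A$. Let $\mathcal F$ be a finite class of functions $\mathcal C\times S\times A\to[0,1]$ that is realizable: some $f_\star\in\mathcal F$ satisfies $f_\star(c,s,a)=r^c_\star(s,a)$ for all $c$, $a$ and all $s\neq s_H$. In round $t=1,\dots,T$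 a context $c_t$ is drawn i.i.d. from an unknown distribution $\mathcal D$ on $\mathcal C$, the learner (who knows $P_\star$) plays a policy $\pi_t(c_t;\cdot)$ and observes a trajectory $(s^t_h,a^t_h,r^t_h)_{h<H}$ of it. The regret is $\mathrm{Regret}_T=\sum_{t=1}^T\big(V^{\pi^\star(c_t;\cdot)}_{P^{c_t}_\star,r^{c_t}_\star}-V^{\pi_t(c_t;\cdot)}_{P^{c_t}_\star,r^{c_t}_\star}\big)$, where $\pi^\star(c;\cdot)$ is optimal for every $c$. **Algorithm RM-KD** (parameters $\beta_t$). In rounds $t\le|A|$ it always plays the $t$-th action. In a round $t>|A|$ it takes a least-squares minimizer $\hat f_t\in\arg\min_{f\in\mathcal F}\sum_{i<t}\sum_{h<H}(f(c_i,s^i_h,a^i_h)-r^i_h)^2$, and for every context $c$ a policy $\pi_t(c;\cdot)\in\arg\max_{\pi:S\to A}V^\pi_{P^c_\star,\hat r^c_t}$, where $$\hat r^c_t(s,a)=\hat f_t(c,s,a)+\frac{\beta_t}{\sum_{i<t}\mathbb 1[a=\pi_i(c;s)]\,q(s\mid\pi_i(c;\cdot),P^c_\star)} .$$ Ties are broken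 by any (measurable) rule depending on the history. **Theorem.** There are universal constants $K>0$ and $k\in\mathbb N$ such that the following holds for all such contextual MDPs, all $T\ge1$ and $\delta\in(0,1)$, when RM-KD is run with $\beta_t=\sqrt{17\,t\log(4|\mathcal F|t^3/\delta)/(|S||A|)}$. 1. With probability at least $1-\delta$, $$\mathrm{Regret}_T\le K(1+\log T)^k\Big(\big(\tfrac1{p_{\min}}+H\big)\sqrt{T|S||A|\log(2|\mathcal F|/\delta)}+|A|H\Big),$$ and if $T>|A|$, then with probability at least $1-\delta$ the same bound holds without the term $|A|H$. 2. Let $\mathcal F=\mathcal G^S$, that is, $\mathcal F$ consists of all $f(c,s,a)=g_s(c,a)$ with $g_s\in\mathcal G$, for a finite class $\mathcal G$ of functions $\mathcal C\times A\to[0,1]$. Then with probability at least $1-\delta$, $$\mathrm{Regret}_T\le K(1+\log T)^k\Big(\big(\tfrac1{p_{\min}}+H\big)|S|\sqrt{T|A|\log(2|\mathcal G|/\delta)}+|A|H\Big),$$ and if $T>|A|$, then with probability at least $1-\delta$ the same bound holds without the term $|A|H$. -/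

import Mathlib

open MeasureTheory

noncomputable section

namespace CMDP

/-- A contextual MDP with horizon `H`, contexts `C`, states `S`, actions `A`.  Contexts are drawn
from `ctxDist`.  The dynamics `P c` of every context is layered and loop-free: `layer c s` is the
index of the layer of `s`, transitions go from each layer to the next one, the first layer is
`{s₀}` and the last one is `{sH}`.  The reward of action `a` in state `s` is drawn from `R c s a`,
a distribution on `[0,1]`.  An episode ends at `sH`, and nothing is collected there. -/
structure LayeredCMDP (C S A : Type*) (H : ℕ) where
  ctxDist : PMF C
  s₀ : S
  sH : S
  layer : C → S → ℕ
  layer_le : ∀ c s, layer c s ≤ H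
  layer_eq_zero_iff : ∀ c s, layer c s = 0 ↔ s = s₀
  layer_eq_H_iff : ∀ c s, layer c s = H ↔ s = sH
  P : C → S → A → PMF S
  P_layer : ∀ c s a s', layer c s < H → P c s a s' ≠ 0 → layer c s' = layer c s + 1
  R : C → S → A → Measure ℝ
  R_prob : ∀ c s a, IsProbabilityMeasure (R c s a)
  R_support : ∀ c s a, ∀ᵐ x ∂(R c s a), x ∈ Set.Icc (0 : ℝ) 1

section MDP

variable {S A : Type*}

/-- The law of the state at time `h` when the policy `π` is played on the dynamics `P`. -/
def stateLaw (P : S → A → PMF S) (s₀ : S) (π : S → A) : ℕ → PMF S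
  | 0 => PMF.pure s₀
  | h + 1 => (stateLaw P s₀ π h).bind fun s => P s (π s)

/-- The occupancy measure `q_h(s | π, P)`. -/
def occ (P : S → A → PMF S) (s₀ : S) (π : S → A) (h : ℕ) (s : S) : ℝ :=
  (stateLaw P s₀ π h s).toReal

/-- The probability `q(s | π, P)` of visiting `s` during an episode.  The dynamics are loop-free, so
`s` is visited at most once and the events "`s` is visited at time `h`" are disjoint. -/
def visitProb (H : ℕ) (P : S → A → PMF S) (s₀ : S) (π : S → A) (s : S) : ℝ :=
  ∑ h ∈ Finset.range (H + 1), occ P s₀ π h s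

/-- The value `V^π(s₀)`, the expectation of `∑_{h < H} r(s_h, π(s_h))`. -/
def value [Fintype S] (H : ℕ) (P : S → A → PMF S) (s₀ : S) (r : S → A → ℝ) (π : S → A) : ℝ :=
  ∑ h ∈ Finset.range H, ∑ s, occ P s₀ π h s * r s (π s)

end MDP

/-- One observed episode: the context and the triples `(s_h, a_h, r_h)` for `h < H`. The state at
time `H` is always `sH` and is not recorded. -/
abbrev Episode (C S A : Type*) (H : ℕ) := C × (Fin H → S × A × ℝ)

/-- The history of the first `t` episodes. -/
abbrev Hist (C S A : Type*) (H t : ℕ) := Fin t → Episode C S A H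

/-- The first `i` episodes of a history. -/
def Hist.pre {C S A : Type*} {H t : ℕ} (hist : Hist C S A H t) (i : Fin t) : Hist C S A H i :=
  fun j => hist ⟨j, j.2.trans i.2⟩

/-- The squared loss `∑_i ∑_h (f(c_i, s_h^i, a_h^i) - r_h^i)²` of `f` on a history. -/
def sqLoss {C S A : Type*} {H t : ℕ} (f : C → S → A → ℝ) (hist : Hist C S A H t) : ℝ :=
  ∑ i, ∑ h, (f (hist i).1 ((hist i).2 h).1 ((hist i).2 h).2.1 - ((hist i).2 h).2.2) ^ 2

namespace LayeredCMDP

variable {C S A : Type*} {H : ℕ} (M : LayeredCMDP C S A H)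

/-- The expected reward `r^c(s,a)`. -/
def meanReward (c : C) (s : S) (a : A) : ℝ := ∫ x, x ∂(M.R c s a)

/-- Minimum reachability with parameter `p`. -/
def MinReach (p : ℝ) : Prop :=
  ∀ (c : C) (h : ℕ) (s : S), h < H → M.layer c s = h →
    ∀ π : C → S → A, p ≤ occ (M.P c) M.s₀ (π c) h s

/-- Realizability of the mean rewards by a class `F` (at the states where rewards are collected). -/
def Realizable (F : Finset (C → S → A → ℝ)) : Prop :=
  ∃ f ∈ F, ∀ c s a, s ≠ M.sH → f c s a = M.meanReward c s a

/-- The value of a policy in the true MDP of context `c`. -/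
def trueValue [Fintype S] (c : C) (π : S → A) : ℝ :=
  value H (M.P c) M.s₀ (M.meanReward c) π

/-- `πs` is an optimal context-dependent policy. -/
def IsOptimal [Fintype S] (πs : C → S → A) : Prop :=
  ∀ (c : C) (π : S → A), M.trueValue c π ≤ M.trueValue c (πs c)

variable [Fintype C] [Fintype S] [MeasurableSpace C] [MeasurableSpace S] [MeasurableSpace A]

/-- The law of `n` consecutive triples (state, action, reward), starting at `s`, when the policy `π`
is played in context `c`: the reward is drawn from `R c s (π s)` and, independently, the next state
from `P c s (π s)`. -/
def trajLaw (c : C) (π : S → A) : (n : ℕ) → S → Measure (Fin n → S × A × ℝ)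
  | 0, _ => Measure.dirac Fin.elim0
  | n + 1, s =>
    ((M.R c s (π s)).prod (∑ s', M.P c s (π s) s' • trajLaw c π n s')).map
      fun x => Fin.cons (α := fun _ => S × A × ℝ) (s, π s, x.1) x.2

/-- The law of an episode in which the context-dependent policy `π` is played: the context is drawn
from `ctxDist`, and then the trajectory is generated by `π c`. -/
def episodeLaw (π : C → S → A) : Measure (Episode C S A H) :=
  ∑ c, M.ctxDist c • (M.trajLaw c (π c) H M.s₀).map (Prod.mk c)

/-- The law of the first `t` episodes when in the round that follows the history `hist` (of length
`i`) the context-dependent policy `π i hist` is played. -/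
def histLaw (π : (i : ℕ) → Hist C S A H i → C → S → A) : (t : ℕ) → Measure (Hist C S A H t)
  | 0 => Measure.dirac Fin.elim0
  | t + 1 => (histLaw π t).bind fun hist =>
      (M.episodeLaw (π t hist)).map (Fin.snoc (α := fun _ => Episode C S A H) hist)

/-- The regret of the policies `π` against `πs` along a history. -/
def regret (πs : C → S → A) (π : (i : ℕ) → Hist C S A H i → C → S → A) {T : ℕ}
    (hist : Hist C S A H T) : ℝ :=
  ∑ t : Fin T, (M.trueValue (hist t).1 (πs (hist t).1) -
    M.trueValue (hist t).1 (π t (hist.pre t) (hist t).1))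

end LayeredCMDP

open Classical in
/-- The optimistic reward function for context `c` after the policies `past 0, …, past (t-1)`:
`f(c,s,a) + b / ∑_{i<t} 𝟙[a = past i (c;s)] q(s | past i (c;·), P)`. -/
def optReward {C S A : Type*} {H t : ℕ} (M : LayeredCMDP C S A H) (f : C → S → A → ℝ) (b : ℝ)
    (past : Fin t → C → S → A) (c : C) (s : S) (a : A) : ℝ :=
  f c s a + b / ∑ i, if a = past i c s then visitProb H (M.P c) M.s₀ (past i c) s else 0

/-- A realization of the algorithm RM-KD with function class `F` and tuning parameters `β`, given by
the choices that the least-squares oracle and the planner make after every history.  Rounds are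
counted from `0`, so that the round after a history of length `t` is round `t + 1` of the usual
numbering and uses `β (t + 1)`. In the first `|A|` rounds the actions are played one after the other.
In a later round, `fhat` is a least-squares minimizer over `F` on the data so far, and the policy is,
in every context, optimal for the true dynamics with the optimistic rewards. -/
structure RMKD {C S A : Type*} {H : ℕ} [Fintype S] [Fintype A] [MeasurableSpace C]
    [MeasurableSpace S] [MeasurableSpace A] (M : LayeredCMDP C S A H)
    (F : Finset (C → S → A → ℝ)) (β : ℕ → ℝ) where
  order : Fin (Fintype.card A) ≃ A
  fhat : (t : ℕ) → Hist C S A H t → C → S → A → ℝ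
  policy : (t : ℕ) → Hist C S A H t → C → S → A
  measurable_policy : ∀ t, Measurable (policy t)
  policy_init : ∀ (t : ℕ) (ht : t < Fintype.card A) (hist : Hist C S A H t) (c : C) (s : S),
    policy t hist c s = order ⟨t, ht⟩
  fhat_mem : ∀ (t : ℕ), Fintype.card A ≤ t → ∀ hist : Hist C S A H t, fhat t hist ∈ F
  fhat_le : ∀ (t : ℕ), Fintype.card A ≤ t → ∀ hist : Hist C S A H t, ∀ f ∈ F,
    sqLoss (fhat t hist) hist ≤ sqLoss f hist
  policy_opt : ∀ (t : ℕ), Fintype.card A ≤ t → ∀ (hist : Hist C S A H t) (c : C) (π : S → A),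
    value H (M.P c) M.s₀
        (optReward M (fhat t hist) (β (t + 1)) (fun i : Fin t => policy i (hist.pre i)) c) π ≤
      value H (M.P c) M.s₀
        (optReward M (fhat t hist) (β (t + 1)) (fun i : Fin t => policy i (hist.pre i)) c)
        (policy t hist c)

/-- `β_t = sqrt (17 t log(4 |F| t³ / δ) / (|S| |A|))`. -/
def beta (cardF cardS cardA : ℕ) (δ : ℝ) (t : ℕ) : ℝ :=
  Real.sqrt (17 * t * Real.log (4 * cardF * (t : ℝ) ^ 3 / δ) / (cardS * cardA))

open Classical in
/-- The class `G^S` of all functions `f(c,s,a) = g_s(c,a)` with `g_s ∈ G` for every state `s`. -/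
def powClass {C S A : Type*} [Fintype S] (G : Finset (C → A → ℝ)) : Finset (C → S → A → ℝ) :=
  (Fintype.piFinset fun _ : S => G).image fun g c s a => g s c a

end CMDP

end

universe u v w

open CMDP

open MeasureTheory

set_option linter.unusedSectionVars false

namespace CMDP

/-! Write `W` for the expected past visits of `(s, a)` in context `c` (`weight`) and `l = log
(2|F|/δ)`. The AM-GM inequality `x ≤ b / W + W x² / (4b)`, with `x` the difference of two reward
functions at a state, bounds the difference of their values by a bonus `b / W` plus a multiple of `W
x²`. The latter is controlled by a change of measure (`value_weight_mul_le`): `W` counts visits by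
the past policies, so its value under any policy is at most the squared error already met along
those policies. This is used twice, for the true rewards against the estimate along the optimal
policy, and for the estimate against the true rewards along the played one. Optimality of the played
policy for the optimistic rewards replaces the bonus of the optimal policy by its own. The result,
averaged over contexts, is `meanGap_le_of_optimistic`: twice the bonus plus `(2b)⁻¹` times the past
squared error.

The squared error is a least-squares matter. The expected excess loss over the true mean is the
squared distance, and its second moment in an episode is at most `4H` times that distance. An
exponential supermartingale (`histLaw_deviation_le`) with a union bound over functions and times
gives an error of order `H l` up to a logarithm (`histLaw_sqError_le`). Only the average over
contexts enters, so nothing is paid for their number. Division by `β_t`, of order at least `√(t l /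
(|S||A|))`, and summation over rounds give the term with `H`.

By minimum reachability `W` is at least `p` times the number of past policies playing `a` in `s`.
The inverses of these counts sum to `|A|(1 + log T)` at most for each state (`sum_inv_count_le`), so
the bonuses give the term with `1/p`. The first `|A|` rounds make all counts positive and cost at
most `H` each. Finally, gaps lie in `[0, H]`, so the realized regret is at most twice the sum of the
expected gaps plus `H log (2/δ)` with probability `1 - δ/2` (`histLaw_regret_le`). -/

theorem occ_nonneg {S A : Type*} (P : S → A → PMF S) (s₀ : S) (π : S → A) (h : ℕ) (s : S) :
    0 ≤ occ P s₀ π h s := ENNReal.toReal_nonneg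

theorem sum_occ {S A : Type*} [Fintype S] (P : S → A → PMF S) (s₀ : S) (π : S → A) (h : ℕ) :
    ∑ s, occ P s₀ π h s = 1 := by
  unfold occ
  rw [← ENNReal.toReal_sum (fun s _ => PMF.apply_ne_top _ s), ← tsum_fintype (L := .unconditional _),
    PMF.tsum_coe, ENNReal.toReal_one]

theorem occ_le_one {S A : Type*} (P : S → A → PMF S) (s₀ : S) (π : S → A) (h : ℕ) (s : S) :
    occ P s₀ π h s ≤ 1 := by
  have := ENNReal.toReal_mono ENNReal.one_ne_top (PMF.coe_le_one (stateLaw P s₀ π h) s)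
  simpa [occ] using this

namespace LayeredCMDP

/-! ### Values as nonnegative linear functionals of the rewards -/

section Occupancy

variable {C S A : Type*} {H : ℕ} (M : LayeredCMDP C S A H)

theorem layer_of_stateLaw_ne_zero (c : C) (π : S → A) (h : ℕ) (hh : h ≤ H) (s : S)
    (hs : stateLaw (M.P c) M.s₀ π h s ≠ 0) : M.layer c s = h := by
  induction h generalizing s with
  | zero =>
    rw [M.layer_eq_zero_iff]
    by_contra hne
    exact hs (by simp [stateLaw, hne])
  | succ h ih =>
    rw [← PMF.mem_support_iff, stateLaw, PMF.mem_support_bind_iff] at hs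
    obtain ⟨s', hs', hss'⟩ := hs
    have h1 := ih (by omega) s' hs'
    rw [← h1]
    exact M.P_layer c s' _ s (by omega) hss'

theorem occ_eq_zero {c : C} {π : S → A} {h : ℕ} (hh : h ≤ H) {s : S} (hs : M.layer c s ≠ h) :
    occ (M.P c) M.s₀ π h s = 0 := by
  unfold occ
  by_contra hne
  exact hs (M.layer_of_stateLaw_ne_zero c π h hh s fun h0 => hne (by simp [h0]))

/-- The probability that a reward is collected in `s`. -/
noncomputable def collectProb (c : C) (π : S → A) (s : S) : ℝ :=
  ∑ h ∈ Finset.range H, occ (M.P c) M.s₀ π h s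

theorem collectProb_nonneg (c : C) (π : S → A) (s : S) : 0 ≤ M.collectProb c π s :=
  Finset.sum_nonneg fun _ _ => occ_nonneg _ _ _ _ _

theorem collectProb_sH (c : C) (π : S → A) : M.collectProb c π M.sH = 0 := by
  refine Finset.sum_eq_zero fun h hh => M.occ_eq_zero (Finset.mem_range.1 hh).le ?_
  rw [(M.layer_eq_H_iff c M.sH).2 rfl]
  exact (Finset.mem_range.1 hh).ne'

theorem layer_lt {c : C} {s : S} (hs : s ≠ M.sH) : M.layer c s < H :=
  lt_of_le_of_ne (M.layer_le c s) fun h => hs ((M.layer_eq_H_iff c s).1 h)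

theorem collectProb_eq_occ {c : C} {π : S → A} {s : S} (hs : s ≠ M.sH) :
    M.collectProb c π s = occ (M.P c) M.s₀ π (M.layer c s) s := by
  refine Finset.sum_eq_single_of_mem _ (Finset.mem_range.2 (M.layer_lt hs)) fun h hh hne => ?_
  exact M.occ_eq_zero (Finset.mem_range.1 hh).le hne.symm

theorem visitProb_eq_collectProb {c : C} {π : S → A} {s : S} (hs : s ≠ M.sH) :
    visitProb H (M.P c) M.s₀ π s = M.collectProb c π s := by
  rw [visitProb, Finset.sum_range_succ, M.occ_eq_zero le_rfl (M.layer_lt hs).ne, add_zero]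
  rfl

theorem collectProb_le_one (c : C) (π : S → A) (s : S) : M.collectProb c π s ≤ 1 := by
  by_cases hs : s = M.sH
  · rw [hs, M.collectProb_sH]; exact zero_le_one
  · rw [M.collectProb_eq_occ hs]; exact occ_le_one _ _ _ _ _

theorem MinReach.le_collectProb {M : LayeredCMDP C S A H} {p : ℝ} (hM : M.MinReach p) {c : C}
    {s : S} (hs : s ≠ M.sH) (π : S → A) : p ≤ M.collectProb c π s := by
  rw [M.collectProb_eq_occ hs]
  exact hM c _ s (M.layer_lt hs) rfl fun _ => π

variable [Fintype S]

/-- The weights are nonnegative, have total mass `H` and vanish at `sH`. Linearity, monotonicity and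
the bounds on values follow, and the terminal state, where realizability says nothing, can be
ignored. -/
theorem value_eq_sum_collectProb (c : C) (r : S → A → ℝ) (π : S → A) :
    value H (M.P c) M.s₀ r π = ∑ s, M.collectProb c π s * r s (π s) := by
  unfold value collectProb
  rw [Finset.sum_comm]
  simp_rw [Finset.sum_mul]

theorem sum_collectProb (c : C) (π : S → A) : ∑ s, M.collectProb c π s = H := by
  unfold collectProb
  rw [Finset.sum_comm]
  simp [sum_occ]

theorem value_mono {c : C} {r r' : S → A → ℝ} {π : S → A}
    (h : ∀ s, s ≠ M.sH → r s (π s) ≤ r' s (π s)) :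
    value H (M.P c) M.s₀ r π ≤ value H (M.P c) M.s₀ r' π := by
  rw [value_eq_sum_collectProb, value_eq_sum_collectProb]
  refine Finset.sum_le_sum fun s _ => ?_
  by_cases hs : s = M.sH
  · rw [hs, M.collectProb_sH]; simp
  · exact mul_le_mul_of_nonneg_left (h s hs) (M.collectProb_nonneg c π s)

theorem value_congr {c : C} {r r' : S → A → ℝ} {π : S → A}
    (h : ∀ s, s ≠ M.sH → r s (π s) = r' s (π s)) :
    value H (M.P c) M.s₀ r π = value H (M.P c) M.s₀ r' π :=
  le_antisymm (M.value_mono fun s hs => (h s hs).le) (M.value_mono fun s hs => (h s hs).ge)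

theorem value_add (c : C) (r r' : S → A → ℝ) (π : S → A) :
    value H (M.P c) M.s₀ (fun s a => r s a + r' s a) π =
      value H (M.P c) M.s₀ r π + value H (M.P c) M.s₀ r' π := by
  simp only [value_eq_sum_collectProb, mul_add, Finset.sum_add_distrib]

theorem value_const_mul (c : C) (b : ℝ) (r : S → A → ℝ) (π : S → A) :
    value H (M.P c) M.s₀ (fun s a => b * r s a) π = b * value H (M.P c) M.s₀ r π := by
  simp only [value_eq_sum_collectProb, Finset.mul_sum]
  exact Finset.sum_congr rfl fun s _ => by ring

theorem value_nonneg {c : C} {r : S → A → ℝ} {π : S → A} (h : ∀ s, s ≠ M.sH → 0 ≤ r s (π s)) :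
    0 ≤ value H (M.P c) M.s₀ r π := by
  have := M.value_mono (r := fun _ _ => 0) (r' := r) (π := π) (c := c) h
  simpa [value] using this

theorem value_le {c : C} {r : S → A → ℝ} {π : S → A} (h : ∀ s, s ≠ M.sH → r s (π s) ≤ 1) :
    value H (M.P c) M.s₀ r π ≤ H := by
  have := M.value_mono (r := r) (r' := fun _ _ => 1) (π := π) (c := c) h
  rwa [M.value_eq_sum_collectProb c (fun _ _ => 1), ← Finset.sum_mul, sum_collectProb,
    mul_one] at this

end Occupancy

/-! ### Bonuses and the change of measure -/

section Bonus

variable {C S A : Type*} {H : ℕ} (M : LayeredCMDP C S A H) {t : ℕ} (past : Fin t → C → S → A)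

open Classical in
/-- The denominator of the bonus: the expected number of past visits of `(s, a)` in context `c`. -/
noncomputable def weight (c : C) (s : S) (a : A) : ℝ :=
  ∑ i, if a = past i c s then visitProb H (M.P c) M.s₀ (past i c) s else 0

open Classical in
/-- The number of past policies that play `a` in state `s` and context `c`. -/
noncomputable def playCount (c : C) (s : S) (a : A) : ℕ :=
  (Finset.univ.filter fun i => past i c s = a).card

theorem optReward_eq (f : C → S → A → ℝ) (b : ℝ) (c : C) :
    optReward M f b past c = fun s a => f c s a + b * (M.weight past c s a)⁻¹ := by
  funext s a
  rw [← div_eq_mul_inv]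
  rfl

theorem weight_eq {c : C} {s : S} (hs : s ≠ M.sH) (a : A) [DecidableEq A] :
    M.weight past c s a = ∑ i, if a = past i c s then M.collectProb c (past i c) s else 0 := by
  unfold weight
  refine Finset.sum_congr rfl fun i _ => ?_
  rw [M.visitProb_eq_collectProb hs]
  congr

theorem weight_nonneg {c : C} {s : S} (hs : s ≠ M.sH) (a : A) : 0 ≤ M.weight past c s a := by
  classical
  rw [M.weight_eq past hs]
  refine Finset.sum_nonneg fun i _ => ?_
  split_ifs
  · exact M.collectProb_nonneg _ _ _
  · exact le_rfl

/-- Every past policy that plays `a` in `s` reaches `s` with probability at least `p`, whatever it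
does elsewhere. -/
theorem MinReach.playCount_le_weight {M : LayeredCMDP C S A H} {p : ℝ} (hM : M.MinReach p)
    {c : C} {s : S} (hs : s ≠ M.sH) (a : A) :
    p * playCount past c s a ≤ M.weight past c s a := by
  classical
  rw [M.weight_eq past hs, ← Finset.sum_filter]
  have h : ∀ i ∈ Finset.univ.filter (fun i => a = past i c s),
      p ≤ M.collectProb c (past i c) s := fun i _ => hM.le_collectProb hs _
  have := Finset.card_nsmul_le_sum _ _ _ h
  rw [nsmul_eq_mul, mul_comm] at this
  have hcard : playCount past c s a = (Finset.univ.filter fun i => a = past i c s).card := by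
    unfold playCount
    congr 1
    ext i
    simp [eq_comm]
  rwa [hcard]

variable [Fintype S]

/-- Change of measure: the visiting probability under `π` is bounded by 1, and the weight of `(s, π
s)` sums the visiting probabilities of those past policies that agree with `π` at `s`, for which `g
s (π s)` is exactly what they collect there. The other past policies contribute nonnegative terms.
-/
theorem value_weight_mul_le {c : C} {g : S → A → ℝ} (hg : ∀ s a, 0 ≤ g s a) (π : S → A) :
    value H (M.P c) M.s₀ (fun s a => M.weight past c s a * g s a) π ≤
      ∑ i, value H (M.P c) M.s₀ g (past i c) := by
  classical
  simp only [value_eq_sum_collectProb]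
  rw [Finset.sum_comm]
  refine Finset.sum_le_sum fun s _ => ?_
  by_cases hs : s = M.sH
  · simp [hs, M.collectProb_sH]
  have hw : 0 ≤ M.weight past c s (π s) * g s (π s) :=
    mul_nonneg (M.weight_nonneg past hs _) (hg _ _)
  refine (mul_le_of_le_one_left hw (M.collectProb_le_one _ _ _)).trans ?_
  rw [M.weight_eq past hs, Finset.sum_mul]
  refine Finset.sum_le_sum fun i _ => ?_
  split_ifs with h
  · rw [h]
  · rw [zero_mul]; exact mul_nonneg (M.collectProb_nonneg _ _ _) (hg _ _)

/-- The values of two reward functions differ by at most the value of the bonus plus the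
squared error along the past policies. -/
theorem value_le_value_add_bonus {c : C} {f g : S → A → ℝ} {b : ℝ} (hb : 0 < b)
    (hw : ∀ s a, s ≠ M.sH → 0 < M.weight past c s a) (π : S → A) :
    value H (M.P c) M.s₀ f π ≤ value H (M.P c) M.s₀ g π +
      b * value H (M.P c) M.s₀ (fun s a => (M.weight past c s a)⁻¹) π +
      (4 * b)⁻¹ * ∑ i, value H (M.P c) M.s₀ (fun s a => (f s a - g s a) ^ 2) (past i c) := by
  have h1 := M.value_weight_mul_le past (c := c) (g := fun s a => (f s a - g s a) ^ 2)
    (fun s a => sq_nonneg _) π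
  have h2 := mul_le_mul_of_nonneg_left h1 (show 0 ≤ (4 * b)⁻¹ by positivity)
  refine le_trans ?_ (add_le_add_right h2 _)
  rw [← value_const_mul, ← value_const_mul, ← value_add, ← value_add]
  refine M.value_mono fun s hs => ?_
  have hW := hw s (π s) hs
  set W := M.weight past c s (π s)
  set x := f s (π s)
  set y := g s (π s)
  -- AM-GM with its defect written as a square; `b / W` is the bonus.
  have key : (4 * b)⁻¹ * (W * (x - y) ^ 2) + b * W⁻¹ - (x - y) =
      (W * (x - y) - 2 * b) ^ 2 / (4 * b * W) := by
    field_simp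
    ring
  have : 0 ≤ (W * (x - y) - 2 * b) ^ 2 / (4 * b * W) := by positivity
  linarith

end Bonus

/-- At the successive times when `u` takes a given value, the count of earlier occurrences runs
through 0, 1, 2, ..., so each value contributes a harmonic sum. The first occurrence contributes
`0⁻¹ = 0`. -/
theorem sum_inv_count_le {A : Type*} [Fintype A] [DecidableEq A] (u : ℕ → A) (T : ℕ) :
    ∑ t ∈ Finset.range T, ((((Finset.range t).filter fun i => u i = u t).card : ℝ))⁻¹ ≤
      Fintype.card A * (1 + Real.log T) := by
  have h1 : ∀ a, ∀ n, ∑ t ∈ Finset.range n, (if u t = a then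
      ((((Finset.range t).filter fun i => u i = a).card : ℝ))⁻¹ else 0) =
      -- With `m` occurrences the largest earlier count is `m - 1`; truncated subtraction covers `m
      -- = 0`.
      (harmonic (((Finset.range n).filter fun i => u i = a).card - 1) : ℝ) := by
    intro a n
    induction n with
    | zero => simp
    | succ n ih =>
      rw [Finset.sum_range_succ, ih, Finset.range_add_one, Finset.filter_insert]
      split_ifs with h
      · rw [Finset.card_insert_of_notMem (by simp)]
        rcases ((Finset.range n).filter fun i => u i = a).card with _ | m
        · simp
        · simp [harmonic_succ]
      · simp
  have h2 : ∀ a, ∑ t ∈ Finset.range T, (if u t = a then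
      ((((Finset.range t).filter fun i => u i = a).card : ℝ))⁻¹ else 0) ≤ 1 + Real.log T := by
    intro a
    rw [h1]
    set m := ((Finset.range T).filter fun i => u i = a).card - 1
    have hm : m ≤ T := (Nat.sub_le _ _).trans ((Finset.card_filter_le _ _).trans (by simp))
    refine (harmonic_le_one_add_log m).trans ?_
    rcases Nat.eq_zero_or_pos m with h0 | h0
    · rw [h0]
      simp [Real.log_natCast_nonneg]
    · gcongr
  calc _ = ∑ t ∈ Finset.range T, ∑ a, (if u t = a then
      ((((Finset.range t).filter fun i => u i = a).card : ℝ))⁻¹ else 0) := by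
        refine Finset.sum_congr rfl fun t _ => ?_
        simp
    _ = ∑ a, ∑ t ∈ Finset.range T, (if u t = a then
      ((((Finset.range t).filter fun i => u i = a).card : ℝ))⁻¹ else 0) := Finset.sum_comm
    _ ≤ ∑ _a : A, (1 + Real.log T) := Finset.sum_le_sum fun a _ => h2 a
    _ = _ := by simp [mul_add]

end LayeredCMDP

/-! ### Measurability tools and an exponential moment bound -/

theorem stateLaw_succ' {S A : Type*} (P : S → A → PMF S) (s₀ : S) (π : S → A) (h : ℕ) :
    stateLaw P s₀ π (h + 1) = (P s₀ (π s₀)).bind fun s => stateLaw P s π h := by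
  induction h with
  | zero => simp [stateLaw]
  | succ h ih =>
    rw [stateLaw, ih, PMF.bind_bind]
    rfl

theorem Hist.measurable_pre {C S A : Type*} [MeasurableSpace C] [MeasurableSpace S]
    [MeasurableSpace A] {H t : ℕ} (i : Fin t) :
    Measurable fun hist : Hist C S A H t => hist.pre i :=
  measurable_pi_lambda _ fun _ => measurable_pi_apply _

theorem isProbabilityMeasure_sum_smul {ι Ω : Type*} [Fintype ι] [MeasurableSpace Ω] (p : PMF ι)
    (μ : ι → Measure Ω) (hμ : ∀ i, IsProbabilityMeasure (μ i)) :
    IsProbabilityMeasure (∑ i, p i • μ i) := by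
  constructor
  simp only [Measure.finsetSum_apply, Measure.smul_apply, measure_univ, smul_eq_mul, mul_one]
  rw [← tsum_fintype (L := .unconditional _), p.tsum_coe]

/-- Applied with the finite type of policies as `Q`: the dependence on the history through the
chosen policy is measurable once each fixed policy is handled. -/
theorem measurable_comp_of_countable {Q X Y Z : Type*} [MeasurableSpace Q] [Countable Q]
    [MeasurableSingletonClass Q] [MeasurableSpace X] [MeasurableSpace Y] [MeasurableSpace Z]
    {f : Q → Y → Z} (hf : ∀ q, Measurable (f q)) {g : X → Q} (hg : Measurable g) {k : X → Y}
    (hk : Measurable k) : Measurable fun x => f (g x) (k x) :=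
  (measurable_from_prod_countable_right (f := fun x : Q × Y => f x.1 x.2) hf).comp (hg.prodMk hk)

theorem measurable_finSnoc {t : ℕ} {E : Type*} [MeasurableSpace E] :
    Measurable fun x : (Fin t → E) × E => Fin.snoc (α := fun _ => E) x.1 x.2 := by
  refine measurable_pi_lambda _ fun i => ?_
  refine Fin.lastCases ?_ (fun i => ?_) i
  · simpa using measurable_snd
  · simpa [Function.comp_def] using (measurable_pi_apply i).comp measurable_fst

theorem measurable_finSnoc_right {t : ℕ} {E : Type*} [MeasurableSpace E] (x : Fin t → E) :
    Measurable (Fin.snoc (α := fun _ => E) x) :=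
  measurable_finSnoc.comp measurable_prodMk_left

theorem measurable_measure_finSnoc_preimage {t : ℕ} {E : Type*} [MeasurableSpace E]
    (μ : Measure E) [SFinite μ] {B : Set (Fin (t + 1) → E)} (hB : MeasurableSet B) :
    Measurable fun x : Fin t → E => μ (Fin.snoc (α := fun _ => E) x ⁻¹' B) :=
  measurable_measure_prodMk_left (measurable_finSnoc hB)

theorem measurable_finCons {t : ℕ} {E : Type*} [MeasurableSpace E] :
    Measurable fun x : E × (Fin t → E) => Fin.cons (α := fun _ => E) x.1 x.2 := by
  refine measurable_pi_lambda _ fun i => ?_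
  refine Fin.cases ?_ (fun i => ?_) i
  · simpa using measurable_fst
  · simpa [Function.comp_def] using (measurable_pi_apply i).comp measurable_snd

/-- Exponential moment bound for a variable in `[-1, 1]`. -/
theorem lintegral_exp_sub_le_one {Ω : Type*} [MeasurableSpace Ω] {μ : Measure Ω}
    [IsProbabilityMeasure μ] {X : Ω → ℝ} (hX : Measurable X) (hX1 : ∀ᵐ ω ∂μ, |X ω| ≤ 1) {v : ℝ}
    (hv : ∫ ω, (X ω + X ω ^ 2) ∂μ ≤ v) :
    ∫⁻ ω, ENNReal.ofReal (Real.exp (X ω - v)) ∂μ ≤ 1 := by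
  have hi : Integrable (fun ω => X ω + X ω ^ 2) μ := by
    refine Integrable.of_bound (by fun_prop) 2 ?_
    filter_upwards [hX1] with ω hω
    have h2 : X ω ^ 2 ≤ 1 := (sq_le_one_iff_abs_le_one _).2 hω
    rw [Real.norm_eq_abs, abs_le]
    have := abs_le.1 hω
    constructor <;> nlinarith [sq_nonneg (X ω)]
  -- This is `e^x ≤ 1 + x + x²` for `|x| ≤ 1`; after integration `1 + v ≤ e^v` finishes.
  have hle : ∀ᵐ ω ∂μ, Real.exp (X ω - v) ≤ Real.exp (-v) * (1 + (X ω + X ω ^ 2)) := by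
    filter_upwards [hX1] with ω hω
    have := (abs_le.1 (Real.abs_exp_sub_one_sub_id_le hω)).2
    rw [sub_eq_neg_add, Real.exp_add]
    exact mul_le_mul_of_nonneg_left (by linarith) (Real.exp_nonneg _)
  have hi2 : Integrable (fun ω => Real.exp (-v) * (1 + (X ω + X ω ^ 2))) μ :=
    ((integrable_const _).add hi).const_mul _
  have hi1 : Integrable (fun ω => Real.exp (X ω - v)) μ := by
    refine hi2.mono' (by fun_prop) ?_
    filter_upwards [hle] with ω hω
    rwa [Real.norm_eq_abs, abs_of_nonneg (Real.exp_nonneg _)]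
  rw [← ofReal_integral_eq_lintegral_ofReal hi1 (.of_forall fun _ => Real.exp_nonneg _)]
  refine ENNReal.ofReal_le_one.2 ((integral_mono_ae hi1 hi2 hle).trans ?_)
  rw [integral_const_mul, integral_add (integrable_const _) hi]
  simp only [integral_const, probReal_univ, smul_eq_mul, one_mul]
  calc _ ≤ Real.exp (-v) * Real.exp v := by
        refine mul_le_mul_of_nonneg_left ?_ (Real.exp_nonneg _)
        linarith [Real.add_one_le_exp v]
    _ = 1 := by rw [← Real.exp_add]; simp

/-! ### Laws of trajectories and episodes -/

namespace LayeredCMDP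

variable {C S A : Type*} {H : ℕ} (M : LayeredCMDP C S A H)
variable [Fintype C] [Fintype S] [Fintype A]
  [MeasurableSpace C] [DiscreteMeasurableSpace C] [MeasurableSpace S]
  [DiscreteMeasurableSpace S] [MeasurableSpace A] [DiscreteMeasurableSpace A]

theorem isProbabilityMeasure_trajLaw (c : C) (π : S → A) (n : ℕ) (s : S) :
    IsProbabilityMeasure (M.trajLaw c π n s) := by
  induction n generalizing s with
  | zero => rw [trajLaw]; infer_instance
  | succ n ih =>
    have := isProbabilityMeasure_sum_smul (M.P c s (π s)) _ ih
    have := M.R_prob c s (π s)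
    rw [trajLaw]
    refine Measure.isProbabilityMeasure_map (Measurable.aemeasurable ?_)
    exact measurable_finCons.comp
      ((measurable_const.prodMk (measurable_const.prodMk measurable_fst)).prodMk measurable_snd)

theorem isProbabilityMeasure_episodeLaw (π : C → S → A) :
    IsProbabilityMeasure (M.episodeLaw π) := by
  refine isProbabilityMeasure_sum_smul M.ctxDist _ fun c => ?_
  have := M.isProbabilityMeasure_trajLaw c (π c) H M.s₀
  exact Measure.isProbabilityMeasure_map measurable_prodMk_left.aemeasurable

/-- The law of the triple observed at time `h`. -/
theorem map_eval_trajLaw (c : C) (π : S → A) (n : ℕ) (s : S) (h : Fin n) :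
    (M.trajLaw c π n s).map (fun τ => τ h) =
      ∑ s', stateLaw (M.P c) s π h s' • (M.R c s' (π s')).map fun x => (s', π s', x) := by
  induction n generalizing s with
  | zero => exact h.elim0
  | succ n ih =>
    have hp := isProbabilityMeasure_sum_smul (M.P c s (π s)) _
      (M.isProbabilityMeasure_trajLaw c π n)
    have hR := M.R_prob c s (π s)
    have hx : ∀ s' : S, Measurable fun x : ℝ => (s', π s', x) := fun s' =>
      measurable_const.prodMk (measurable_const.prodMk measurable_id)
    have hm : Measurable fun x : ℝ × (Fin n → S × A × ℝ) =>
        Fin.cons (α := fun _ => S × A × ℝ) (s, π s, x.1) x.2 :=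
      measurable_finCons.comp (((hx s).comp measurable_fst).prodMk measurable_snd)
    rw [trajLaw, Measure.map_map (measurable_pi_apply h) hm]
    refine Fin.cases ?_ (fun h => ?_) h
    · have : (fun τ : Fin (n + 1) → S × A × ℝ => τ 0) ∘ (fun x : ℝ × (Fin n → S × A × ℝ) =>
          Fin.cons (α := fun _ => S × A × ℝ) (s, π s, x.1) x.2) =
          (fun x : ℝ => (s, π s, x)) ∘ Prod.fst := by
        funext x; simp
      rw [this, ← Measure.map_map (hx s) measurable_fst, Measure.map_fst_prod, measure_univ,
        one_smul, Finset.sum_eq_single s]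
      · simp [stateLaw]
      · intro s' _ hs'
        simp [stateLaw, hs']
      · simp
    · have : (fun τ : Fin (n + 1) → S × A × ℝ => τ h.succ) ∘ (fun x : ℝ × (Fin n → S × A × ℝ) =>
          Fin.cons (α := fun _ => S × A × ℝ) (s, π s, x.1) x.2) =
          (fun τ : Fin n → S × A × ℝ => τ h) ∘ Prod.snd := by
        funext x; simp
      rw [this, ← Measure.map_map (measurable_pi_apply h) measurable_snd, Measure.map_snd_prod,
        measure_univ, one_smul, Measure.map_finset_sum (measurable_pi_apply h).aemeasurable]
      -- `trajLaw` recurses on the first transition, hence the state law is expanded from its first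
      -- step too.
      simp_rw [Measure.map_smul, ih, Fin.val_succ, stateLaw_succ', PMF.bind_apply, tsum_fintype,
        Finset.smul_sum, Finset.sum_smul, smul_smul]
      rw [Finset.sum_comm]

theorem ae_reward_mem_trajLaw (c : C) (π : S → A) :
    ∀ᵐ τ ∂M.trajLaw c π H M.s₀, ∀ h, (τ h).2.2 ∈ Set.Icc (0 : ℝ) 1 := by
  rw [ae_all_iff]
  intro h
  have hmeas : MeasurableSet {x : S × A × ℝ | x.2.2 ∈ Set.Icc (0 : ℝ) 1} :=
    measurable_snd.snd measurableSet_Icc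
  refine ae_of_ae_map (f := fun τ : Fin H → S × A × ℝ => τ h)
    (p := fun x : S × A × ℝ => x.2.2 ∈ Set.Icc (0 : ℝ) 1)
    (measurable_pi_apply h).aemeasurable ?_
  rw [map_eval_trajLaw, ae_iff, Measure.finsetSum_apply]
  refine Finset.sum_eq_zero fun s' _ => ?_
  have h1 : ∀ᵐ x ∂(M.R c s' (π s')).map (fun x => (s', π s', x)),
      x.2.2 ∈ Set.Icc (0 : ℝ) 1 := by
    rw [ae_map_iff (measurable_const.prodMk
      (measurable_const.prodMk measurable_id')).aemeasurable hmeas]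
    exact M.R_support c s' (π s')
  rw [ae_iff] at h1
  rw [Measure.smul_apply, h1, smul_zero]

theorem ae_reward_mem_episodeLaw (π : C → S → A) :
    ∀ᵐ e ∂M.episodeLaw π, ∀ h, (e.2 h).2.2 ∈ Set.Icc (0 : ℝ) 1 := by
  have hmeas : MeasurableSet {e : Episode C S A H | ∀ h, (e.2 h).2.2 ∈ Set.Icc (0 : ℝ) 1} := by
    rw [Set.ofPred_forall]
    exact MeasurableSet.iInter fun h =>
      ((measurable_pi_apply h).comp measurable_snd).snd.snd measurableSet_Icc
  rw [ae_iff, episodeLaw, Measure.finsetSum_apply]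
  refine Finset.sum_eq_zero fun c _ => ?_
  have h1 : ∀ᵐ e ∂(M.trajLaw c (π c) H M.s₀).map (Prod.mk c),
      ∀ h, (e.2 h).2.2 ∈ Set.Icc (0 : ℝ) 1 := by
    rw [ae_map_iff measurable_prodMk_left.aemeasurable hmeas]
    exact M.ae_reward_mem_trajLaw c (π c)
  rw [ae_iff] at h1
  rw [Measure.smul_apply, h1, smul_zero]

theorem integral_episodeLaw (π : C → S → A) {X : Episode C S A H → ℝ} (hX : Measurable X) {B : ℝ}
    (hB : ∀ᵐ e ∂M.episodeLaw π, |X e| ≤ B) :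
    ∫ e, X e ∂M.episodeLaw π =
      ∑ c, (M.ctxDist c).toReal * ∫ τ, X (c, τ) ∂M.trajLaw c (π c) H M.s₀ := by
  have := M.isProbabilityMeasure_episodeLaw π
  have hi : Integrable X (M.episodeLaw π) := .of_bound hX.aestronglyMeasurable B hB
  have hle : ∀ c, M.ctxDist c • (M.trajLaw c (π c) H M.s₀).map (Prod.mk c) ≤ M.episodeLaw π :=
    fun c => by
      rw [episodeLaw]
      exact Finset.single_le_sum (f := fun c => M.ctxDist c •
        (M.trajLaw c (π c) H M.s₀).map (Prod.mk c)) (fun _ _ => Measure.zero_le _) (Finset.mem_univ c)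
  rw [episodeLaw, integral_finsetSum_measure fun c _ => hi.mono_measure (hle c)]
  refine Finset.sum_congr rfl fun c _ => ?_
  rw [integral_smul_measure, integral_map measurable_prodMk_left.aemeasurable
    hX.aestronglyMeasurable, smul_eq_mul]

/-- The expectation of a sum over the steps of an episode. -/
theorem integral_trajLaw_sum (c : C) (π : S → A) {g : S × A × ℝ → ℝ} (hg : Measurable g) {B : ℝ}
    (hB : ∀ s a, ∀ x ∈ Set.Icc (0 : ℝ) 1, |g (s, a, x)| ≤ B) :
    ∫ τ, ∑ h, g (τ h) ∂M.trajLaw c π H M.s₀ =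
      value H (M.P c) M.s₀ (fun s a => ∫ x, g (s, a, x) ∂M.R c s a) π := by
  have := M.isProbabilityMeasure_trajLaw c π H M.s₀
  have hRp := M.R_prob
  have hi : ∀ h, Integrable (fun τ => g (τ h)) (M.trajLaw c π H M.s₀) := fun h => by
    refine .of_bound (hg.comp (measurable_pi_apply h)).aestronglyMeasurable B ?_
    filter_upwards [M.ae_reward_mem_trajLaw c π] with τ hτ
    exact hB _ _ _ (hτ h)
  rw [integral_finsetSum _ fun h _ => hi h, value, Finset.sum_range]
  refine Finset.sum_congr rfl fun h _ => ?_
  have hx : ∀ s' : S, Measurable fun x : ℝ => (s', π s', x) := fun s' =>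
    measurable_const.prodMk (measurable_const.prodMk measurable_id)
  rw [← integral_map (φ := fun τ : Fin H → S × A × ℝ => τ h) (f := g)
    (measurable_pi_apply h).aemeasurable hg.aestronglyMeasurable, map_eval_trajLaw,
    integral_finsetSum_measure]
  · refine Finset.sum_congr rfl fun s' _ => ?_
    rw [integral_smul_measure, integral_map (hx s').aemeasurable hg.aestronglyMeasurable,
      smul_eq_mul]
    rfl
  · intro s' _
    refine Integrable.smul_measure ?_ (PMF.apply_ne_top _ _)
    rw [integrable_map_measure hg.aestronglyMeasurable (hx s').aemeasurable]
    refine .of_bound (hg.comp (hx s')).aestronglyMeasurable B ?_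
    filter_upwards [M.R_support c s' (π s')] with x hx'
    exact hB _ _ _ hx'

/-! ### Concentration along adaptively generated histories -/

variable {π : (i : ℕ) → Hist C S A H i → C → S → A}

theorem measurable_episodeLaw_snoc (hπ : ∀ t, Measurable (π t)) (t : ℕ) :
    Measurable fun hist : Hist C S A H t =>
      (M.episodeLaw (π t hist)).map (Fin.snoc (α := fun _ => Episode C S A H) hist) := by
  refine Measure.measurable_of_measurable_coe _ fun B hB => ?_
  simp_rw [Measure.map_apply (measurable_finSnoc_right _) hB]
  have h1 : ∀ q : C → S → A, Measurable fun hist : Hist C S A H t =>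
      M.episodeLaw q (Fin.snoc (α := fun _ => Episode C S A H) hist ⁻¹' B) := fun q => by
    have := M.isProbabilityMeasure_episodeLaw q
    exact measurable_measure_finSnoc_preimage _ hB
  exact measurable_comp_of_countable h1 (hπ t) measurable_id

theorem isProbabilityMeasure_histLaw (hπ : ∀ t, Measurable (π t)) (t : ℕ) :
    IsProbabilityMeasure (M.histLaw π t) := by
  induction t with
  | zero => rw [histLaw]; infer_instance
  | succ t ih =>
    constructor
    rw [histLaw, Measure.bind_apply .univ (M.measurable_episodeLaw_snoc hπ t).aemeasurable]
    have : ∀ hist : Hist C S A H t, (M.episodeLaw (π t hist)).map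
        (Fin.snoc (α := fun _ => Episode C S A H) hist) Set.univ = 1 := fun hist => by
      have := M.isProbabilityMeasure_episodeLaw (π t hist)
      rw [Measure.map_apply (measurable_finSnoc_right _) .univ, Set.preimage_univ, measure_univ]
    simp [this]

theorem measurable_prod_histories (hπ : ∀ t, Measurable (π t))
    {ψ : ℕ → (C → S → A) → Episode C S A H → ENNReal}
    (hψ : ∀ i q, Measurable (ψ i q)) (t : ℕ) :
    Measurable fun hist : Hist C S A H t => ∏ i : Fin t, ψ i (π i (hist.pre i)) (hist i) := by
  refine Finset.measurable_fun_prod _ fun i _ => ?_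
  exact measurable_comp_of_countable (hψ i) ((hπ i).comp (Hist.measurable_pre i))
    (measurable_pi_apply i)

/-- Supermartingale property: given the first `t` episodes, the next one has the law `episodeLaw` of
the policy chosen from them, so integrating out the last factor does not increase the integral. -/
theorem lintegral_prod_histLaw_le_one (hπ : ∀ t, Measurable (π t))
    {ψ : ℕ → (C → S → A) → Episode C S A H → ENNReal}
    (hψ : ∀ i q, Measurable (ψ i q)) (hψ1 : ∀ i q, ∫⁻ e, ψ i q e ∂M.episodeLaw q ≤ 1) (t : ℕ) :
    ∫⁻ hist, ∏ i : Fin t, ψ i (π i (hist.pre i)) (hist i) ∂M.histLaw π t ≤ 1 := by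
  induction t with
  | zero => simp [histLaw]
  | succ t ih =>
    rw [histLaw, Measure.lintegral_bind (M.measurable_episodeLaw_snoc hπ t).aemeasurable
      (measurable_prod_histories hπ hψ _).aemeasurable]
    refine le_trans (lintegral_mono fun hist => ?_) ih
    rw [lintegral_map (measurable_prod_histories hπ hψ _)
      (measurable_finSnoc_right _)]
    have hpre : ∀ e, (Hist.pre (Fin.snoc (α := fun _ => Episode C S A H) hist e : Hist C S A H (t + 1))
        (Fin.last t)) = hist := fun e => by
      funext j
      exact Fin.snoc_castSucc (α := fun _ => Episode C S A H) e hist j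
    have hpre' : ∀ e (i : Fin t), (Hist.pre
        (Fin.snoc (α := fun _ => Episode C S A H) hist e : Hist C S A H (t + 1)) i.castSucc) =
        hist.pre i := fun e i => by
      funext j
      exact Fin.snoc_castSucc (α := fun _ => Episode C S A H) e hist ⟨j, j.2.trans i.2⟩
    have hprod : ∀ e : Episode C S A H, ∏ i : Fin (t + 1), ψ i (π i (Hist.pre
        (Fin.snoc (α := fun _ => Episode C S A H) hist e : Hist C S A H (t + 1)) i))
        (Fin.snoc (α := fun _ => Episode C S A H) hist e i) =
        (∏ i : Fin t, ψ i (π i (hist.pre i)) (hist i)) * ψ t (π t hist) e := fun e => by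
      rw [Fin.prod_univ_castSucc]
      congr 1
      · refine Finset.prod_congr rfl fun i _ => ?_
        rw [hpre', Fin.snoc_castSucc]
        rfl
      · rw [hpre, Fin.snoc_last]
        rfl
    simp_rw [hprod]
    rw [lintegral_const_mul _ (hψ _ _)]
    exact mul_le_of_le_one_right (zero_le) (hψ1 _ _)

/-- A Freedman-type deviation bound along the histories. -/
theorem histLaw_deviation_le (hπ : ∀ t, Measurable (π t))
    {X : ℕ → (C → S → A) → Episode C S A H → ℝ}
    {v : ℕ → (C → S → A) → ℝ} (hX : ∀ i q, Measurable (X i q))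
    (hX1 : ∀ i q, ∀ᵐ e ∂M.episodeLaw q, |X i q e| ≤ 1)
    (hv : ∀ i q, ∫ e, (X i q e + X i q e ^ 2) ∂M.episodeLaw q ≤ v i q) (t : ℕ) {ε : ℝ}
    (hε : 0 < ε) :
    M.histLaw π t {hist | Real.log (1 / ε) <
      ∑ i : Fin t, (X i (π i (hist.pre i)) (hist i) - v i (π i (hist.pre i)))} ≤ ENNReal.ofReal ε := by
  set ψ : ℕ → (C → S → A) → Episode C S A H → ENNReal := fun i q e =>
    ENNReal.ofReal (Real.exp (X i q e - v i q))
  have hψ : ∀ i q, Measurable (ψ i q) := fun i q => by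
    have := hX i q
    fun_prop
  have h1 := M.lintegral_prod_histLaw_le_one hπ hψ (fun i q => by
    have := M.isProbabilityMeasure_episodeLaw q
    exact lintegral_exp_sub_le_one (hX i q) (hX1 i q) (hv i q)) t
  -- Markov's inequality for the exponential of the sum, at level `1 / ε`.
  have h2 := (mul_meas_ge_le_lintegral₀ (measurable_prod_histories hπ hψ t).aemeasurable
    (μ := M.histLaw π t) (ENNReal.ofReal (1 / ε))).trans h1
  have h3 : {hist : Hist C S A H t | Real.log (1 / ε) <
      ∑ i : Fin t, (X i (π i (hist.pre i)) (hist i) - v i (π i (hist.pre i)))} ⊆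
      {hist | ENNReal.ofReal (1 / ε) ≤ ∏ i : Fin t, ψ i (π i (hist.pre i)) (hist i)} := fun hist hh => by
    simp only [Set.mem_ofPred_eq, ψ] at hh ⊢
    rw [← ENNReal.ofReal_prod_of_nonneg fun _ _ => Real.exp_nonneg _, ← Real.exp_sum]
    refine ENNReal.ofReal_le_ofReal ?_
    rw [← Real.log_le_iff_le_exp (by positivity)]
    exact hh.le
  refine (measure_mono h3).trans ?_
  rw [one_div, ENNReal.ofReal_inv_of_pos hε, mul_comm, ← div_eq_mul_inv] at h2
  have := (ENNReal.div_le_iff (ENNReal.ofReal_pos.2 hε).ne' ENNReal.ofReal_ne_top).1 h2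
  rwa [one_mul, ← ENNReal.ofReal_inv_of_pos hε, ← one_div] at this

end LayeredCMDP

/-! ### Least-squares error and regret: deviation bounds -/

theorem sum_ite_lt_eq_sum_castLE {t T : ℕ} (h : t ≤ T) (F : Fin T → ℝ) :
    ∑ i, (if i.val < t then F i else 0) = ∑ i : Fin t, F (Fin.castLE h i) := by
  obtain ⟨k, rfl⟩ := Nat.exists_eq_add_of_le h
  rw [Fin.sum_univ_add]
  simp only [Fin.val_castAdd, Fin.is_lt, if_true, Fin.val_natAdd, not_lt.2 (Nat.le_add_right _ _),
    if_false, Finset.sum_const_zero, add_zero]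
  rfl

theorem measurable_uncurry_triple {S A : Type*} [Countable S] [Countable A] [MeasurableSpace S]
    [DiscreteMeasurableSpace S] [MeasurableSpace A] [DiscreteMeasurableSpace A] (f : S → A → ℝ) :
    Measurable fun x : S × A × ℝ => f x.1 x.2.1 :=
  (measurable_of_countable fun x : S × A => f x.1 x.2).comp
    (measurable_fst.prodMk measurable_snd.fst)

/-- The excess squared loss of `f` over `g` on one episode. -/
def excessLoss {C S A : Type*} {H : ℕ} (f g : C → S → A → ℝ) (e : Episode C S A H) : ℝ :=
  ∑ h, ((f e.1 (e.2 h).1 (e.2 h).2.1 - (e.2 h).2.2) ^ 2 -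
    (g e.1 (e.2 h).1 (e.2 h).2.1 - (e.2 h).2.2) ^ 2)

theorem sqLoss_sub_sqLoss {C S A : Type*} {H t : ℕ} (f g : C → S → A → ℝ)
    (hist : Hist C S A H t) : sqLoss f hist - sqLoss g hist = ∑ i, excessLoss f g (hist i) := by
  simp only [sqLoss, excessLoss, Finset.sum_sub_distrib]

namespace LayeredCMDP

variable {C S A : Type*} {H : ℕ} (M : LayeredCMDP C S A H)
variable [Fintype C] [Fintype S]

/-- The expected squared distance of `f` and `g` along an episode of the policy `π`. -/
noncomputable def sqError (f g : C → S → A → ℝ) (π : C → S → A) : ℝ :=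
  ∑ c, (M.ctxDist c).toReal * value H (M.P c) M.s₀ (fun s a => (f c s a - g c s a) ^ 2) (π c)

/-- The suboptimality of `π` in context `c`. -/
noncomputable def gap (πs π : C → S → A) (c : C) : ℝ :=
  M.trueValue c (πs c) - M.trueValue c (π c)

/-- The expected suboptimality of `π`. -/
noncomputable def meanGap (πs π : C → S → A) : ℝ :=
  ∑ c, (M.ctxDist c).toReal * M.gap πs π c

theorem sum_ctxDist : ∑ c, (M.ctxDist c).toReal = 1 := by
  rw [← ENNReal.toReal_sum (fun s _ => PMF.apply_ne_top _ s), ← tsum_fintype (L := .unconditional _),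
    PMF.tsum_coe, ENNReal.toReal_one]

theorem gap_nonneg {πs : C → S → A} (h : M.IsOptimal πs) (π : C → S → A) (c : C) :
    0 ≤ M.gap πs π c := sub_nonneg.2 (h c (π c))

theorem meanReward_mem (c : C) (s : S) (a : A) : M.meanReward c s a ∈ Set.Icc (0 : ℝ) 1 := by
  have := M.R_prob c s a
  have hi : Integrable (fun x : ℝ => x) (M.R c s a) := by
    refine .of_bound measurable_id.aestronglyMeasurable 1 ?_
    filter_upwards [M.R_support c s a] with x hx
    rw [Real.norm_eq_abs, abs_of_nonneg hx.1]
    exact hx.2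
  constructor
  · exact integral_nonneg_of_ae ((M.R_support c s a).mono fun x hx => hx.1)
  · have := integral_mono_ae hi (integrable_const 1) ((M.R_support c s a).mono fun x hx => hx.2)
    simpa [meanReward] using this

theorem gap_le (πs π : C → S → A) (c : C) : M.gap πs π c ≤ H := by
  have h1 : M.trueValue c (πs c) ≤ H := M.value_le fun s _ => (M.meanReward_mem c s _).2
  have h2 : 0 ≤ M.trueValue c (π c) := M.value_nonneg fun s _ => (M.meanReward_mem c s _).1
  unfold gap
  linarith

theorem meanGap_le (πs π : C → S → A) : M.meanGap πs π ≤ H := by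
  calc _ ≤ ∑ c, (M.ctxDist c).toReal * (H : ℝ) :=
        Finset.sum_le_sum fun c _ => mul_le_mul_of_nonneg_left (M.gap_le _ _ _)
          ENNReal.toReal_nonneg
    _ = H := by rw [← Finset.sum_mul, sum_ctxDist, one_mul]

variable [Fintype A]
  [MeasurableSpace C] [DiscreteMeasurableSpace C] [MeasurableSpace S]
  [DiscreteMeasurableSpace S] [MeasurableSpace A] [DiscreteMeasurableSpace A]

theorem measurable_episode_sum {g : C → S × A × ℝ → ℝ} (hg : ∀ c, Measurable (g c)) :
    Measurable fun e : Episode C S A H => ∑ h, g e.1 (e.2 h) :=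
  Finset.measurable_fun_sum _ fun h _ => measurable_comp_of_countable hg measurable_fst
    ((measurable_pi_apply h).comp measurable_snd)

theorem ae_abs_episode_sum_le (π : C → S → A) {g : C → S × A × ℝ → ℝ} {B : ℝ}
    (hB : ∀ c s a, ∀ x ∈ Set.Icc (0 : ℝ) 1, |g c (s, a, x)| ≤ B) :
    ∀ᵐ e ∂M.episodeLaw π, |∑ h, g e.1 (e.2 h)| ≤ H * B := by
  filter_upwards [M.ae_reward_mem_episodeLaw π] with e he
  refine (Finset.abs_sum_le_sum_abs _ _).trans ?_
  refine (Finset.sum_le_card_nsmul _ _ B fun h _ => hB _ _ _ _ (he h)).trans ?_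
  simp

theorem integral_episodeLaw_sum (π : C → S → A) {g : C → S × A × ℝ → ℝ}
    (hg : ∀ c, Measurable (g c)) {B : ℝ}
    (hB : ∀ c s a, ∀ x ∈ Set.Icc (0 : ℝ) 1, |g c (s, a, x)| ≤ B) :
    ∫ e, ∑ h, g e.1 (e.2 h) ∂M.episodeLaw π = ∑ c, (M.ctxDist c).toReal *
      value H (M.P c) M.s₀ (fun s a => ∫ x, g c (s, a, x) ∂M.R c s a) (π c) := by
  rw [M.integral_episodeLaw π (measurable_episode_sum hg) (M.ae_abs_episode_sum_le π hB)]
  refine Finset.sum_congr rfl fun c _ => ?_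
  rw [M.integral_trajLaw_sum c (π c) (hg c) (hB c)]

theorem measurable_excessLoss (f g : C → S → A → ℝ) :
    Measurable (excessLoss f g : Episode C S A H → ℝ) := by
  refine measurable_episode_sum (g := fun c x => (f c x.1 x.2.1 - x.2.2) ^ 2 -
    (g c x.1 x.2.1 - x.2.2) ^ 2) fun c => ?_
  have h1 := measurable_uncurry_triple (f c)
  have h2 := measurable_uncurry_triple (g c)
  fun_prop

theorem ae_abs_excessLoss_le (π : C → S → A) {f g : C → S → A → ℝ}
    (hf : ∀ c s a, f c s a ∈ Set.Icc (0 : ℝ) 1) (hg : ∀ c s a, g c s a ∈ Set.Icc (0 : ℝ) 1) :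
    ∀ᵐ e ∂M.episodeLaw π, |excessLoss f g e| ≤ H := by
  have := M.ae_abs_episode_sum_le π (B := 1) (g := fun c x => (f c x.1 x.2.1 - x.2.2) ^ 2 -
    (g c x.1 x.2.1 - x.2.2) ^ 2) fun c s a x hx => by
      obtain ⟨f0, f1⟩ := hf c s a
      obtain ⟨g0, g1⟩ := hg c s a
      obtain ⟨x0, x1⟩ := hx
      have h1 : (f c s a - x) ^ 2 ≤ 1 := by
        rw [sq_le_one_iff_abs_le_one, abs_le]; constructor <;> linarith
      have h2 : (g c s a - x) ^ 2 ≤ 1 := by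
        rw [sq_le_one_iff_abs_le_one, abs_le]; constructor <;> linarith
      rw [abs_le]
      constructor <;> nlinarith [sq_nonneg (f c s a - x), sq_nonneg (g c s a - x)]
  rw [mul_one] at this
  exact this

/-- Since `g` is the mean reward, the excess loss has expectation `sqError f g π`. By Cauchy-Schwarz
over the `H` steps its square has expectation at most `4H` times that. The scaling `1 / (8H)` leaves
`-1/(8H) + 4H/(8H)² = -1/(16H)`. -/
theorem integral_excessLoss_moment_le (hH : 0 < H) (π : C → S → A) {f g : C → S → A → ℝ}
    (hf : ∀ c s a, f c s a ∈ Set.Icc (0 : ℝ) 1) (hg : ∀ c s a, g c s a ∈ Set.Icc (0 : ℝ) 1)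
    (hgM : ∀ c s a, s ≠ M.sH → g c s a = M.meanReward c s a) :
    ∫ e, (-(excessLoss f g e) / (8 * H) + (-(excessLoss f g e) / (8 * H)) ^ 2) ∂M.episodeLaw π ≤
      -(M.sqError f g π) / (16 * H) := by
  have hH' : (1 : ℝ) ≤ H := by exact_mod_cast hH
  have hH0 : (0 : ℝ) < H := by linarith
  have := M.isProbabilityMeasure_episodeLaw π
  -- A sum over steps that dominates `X + X²`, so that its expectation becomes a value.
  set G : C → S × A × ℝ → ℝ := fun c x =>
    -((f c x.1 x.2.1 - x.2.2) ^ 2 - (g c x.1 x.2.1 - x.2.2) ^ 2) / (8 * H) +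
      (f c x.1 x.2.1 - g c x.1 x.2.1) ^ 2 / (16 * H) with hG
  have hGm : ∀ c, Measurable (G c) := fun c => by
    have h1 := measurable_uncurry_triple (f c)
    have h2 := measurable_uncurry_triple (g c)
    fun_prop
  have hGB : ∀ c s a, ∀ x ∈ Set.Icc (0 : ℝ) 1, |G c (s, a, x)| ≤ 2 := fun c s a x hx => by
    obtain ⟨f0, f1⟩ := hf c s a
    obtain ⟨g0, g1⟩ := hg c s a
    obtain ⟨x0, x1⟩ := hx
    have h1 : (f c s a - x) ^ 2 ≤ 1 := by
      rw [sq_le_one_iff_abs_le_one, abs_le]; constructor <;> linarith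
    have h2 : (g c s a - x) ^ 2 ≤ 1 := by
      rw [sq_le_one_iff_abs_le_one, abs_le]; constructor <;> linarith
    have h3 : (f c s a - g c s a) ^ 2 ≤ 1 := by
      rw [sq_le_one_iff_abs_le_one, abs_le]; constructor <;> linarith
    have e : G c (s, a, x) = (-2 * ((f c s a - x) ^ 2 - (g c s a - x) ^ 2) +
        (f c s a - g c s a) ^ 2) / (16 * H) := by
      simp only [hG]; field_simp; ring
    rw [e, abs_div, abs_of_pos (by positivity : (0 : ℝ) < 16 * H), div_le_iff₀ (by positivity),
      abs_le]
    have := sq_nonneg (f c s a - x)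
    have := sq_nonneg (g c s a - x)
    have := sq_nonneg (f c s a - g c s a)
    constructor <;> linarith
  have hXm := measurable_excessLoss (H := H) f g
  have hi1 : Integrable (fun e => -(excessLoss f g e) / (8 * H) +
      (-(excessLoss f g e) / (8 * H)) ^ 2) (M.episodeLaw π) := by
    refine .of_bound (by fun_prop) 2 ?_
    filter_upwards [M.ae_abs_excessLoss_le π hf hg] with e he
    have h1 : |-(excessLoss f g e) / (8 * H)| ≤ 1 := by
      rw [abs_div, abs_neg, abs_of_pos (by positivity : (0 : ℝ) < 8 * H),
        div_le_one (by positivity)]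
      linarith
    have h2 := (sq_le_one_iff_abs_le_one _).2 h1
    rw [abs_le] at h1
    rw [Real.norm_eq_abs, abs_le]
    have := sq_nonneg (-(excessLoss f g e) / (8 * H))
    constructor <;> linarith
  have hi2 : Integrable (fun e : Episode C S A H => ∑ h, G e.1 (e.2 h)) (M.episodeLaw π) :=
    .of_bound (measurable_episode_sum hGm).aestronglyMeasurable _ (M.ae_abs_episode_sum_le π hGB)
  have hle : ∀ᵐ e ∂M.episodeLaw π, -(excessLoss f g e) / (8 * H) +
      (-(excessLoss f g e) / (8 * H)) ^ 2 ≤ ∑ h, G e.1 (e.2 h) := by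
    filter_upwards [M.ae_reward_mem_episodeLaw π] with e he
    have h1 : (excessLoss f g e) ^ 2 ≤ H * ∑ h,
        (4 * (f e.1 (e.2 h).1 (e.2 h).2.1 - g e.1 (e.2 h).1 (e.2 h).2.1) ^ 2) := by
      have := sq_sum_le_card_mul_sum_sq (s := (Finset.univ : Finset (Fin H)))
        (f := fun h => (f e.1 (e.2 h).1 (e.2 h).2.1 - (e.2 h).2.2) ^ 2 -
          (g e.1 (e.2 h).1 (e.2 h).2.1 - (e.2 h).2.2) ^ 2)
      rw [Finset.card_univ, Fintype.card_fin] at this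
      refine this.trans (mul_le_mul_of_nonneg_left (Finset.sum_le_sum fun h _ => ?_) hH0.le)
      obtain ⟨f0, f1⟩ := hf e.1 (e.2 h).1 (e.2 h).2.1
      obtain ⟨g0, g1⟩ := hg e.1 (e.2 h).1 (e.2 h).2.1
      obtain ⟨x0, x1⟩ := he h
      set a := f e.1 (e.2 h).1 (e.2 h).2.1
      set b := g e.1 (e.2 h).1 (e.2 h).2.1
      set x := (e.2 h).2.2
      -- The second factor has modulus at most 2, whence the constant 4.
      have e1 : (a - x) ^ 2 - (b - x) ^ 2 = (a - b) * (a + b - 2 * x) := by ring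
      have e2 : (a + b - 2 * x) ^ 2 ≤ 2 ^ 2 := by
        refine sq_le_sq' ?_ ?_ <;> linarith
      rw [e1, mul_pow]
      nlinarith [sq_nonneg (a - b)]
    have h2 : ∑ h, G e.1 (e.2 h) = -(excessLoss f g e) / (8 * H) + (∑ h,
        (4 * (f e.1 (e.2 h).1 (e.2 h).2.1 - g e.1 (e.2 h).1 (e.2 h).2.1) ^ 2)) / (64 * H) := by
      simp only [hG, Finset.sum_add_distrib, ← Finset.sum_div, Finset.sum_neg_distrib,
        ← Finset.mul_sum]
      unfold excessLoss
      congr 1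
      field_simp
      ring
    rw [h2]
    refine add_le_add_right ?_ _
    rw [div_pow, neg_sq, div_le_div_iff₀ (by positivity) (by positivity)]
    nlinarith
  refine (integral_mono_ae hi1 hi2 hle).trans (le_of_eq ?_)
  rw [M.integral_episodeLaw_sum π hGm hGB, sqError, ← Finset.sum_neg_distrib, Finset.sum_div]
  refine Finset.sum_congr rfl fun c _ => ?_
  rw [← mul_neg, mul_div_assoc]
  congr 1
  have : ∀ s, s ≠ M.sH → ∫ x, G c (s, π c s, x) ∂M.R c s (π c s) =
      -(16 * H : ℝ)⁻¹ * (f c s (π c s) - g c s (π c s)) ^ 2 := fun s hs => by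
    have hRp := M.R_prob c s (π c s)
    have hxi : Integrable (fun x : ℝ => x) (M.R c s (π c s)) := by
      refine .of_bound measurable_id.aestronglyMeasurable 1 ?_
      filter_upwards [M.R_support c s (π c s)] with x hx
      rw [Real.norm_eq_abs, abs_of_nonneg hx.1]
      exact hx.2
    set a := f c s (π c s)
    have hb := hgM c s (π c s) hs
    set b := g c s (π c s)
    -- The quadratic terms in the reward cancel, so only its mean matters.
    have e1 : ∀ x, G c (s, π c s, x) = ((a - b) / (4 * H)) * x +
        (-(a ^ 2 - b ^ 2) / (8 * H) + (a - b) ^ 2 / (16 * H)) := fun x => by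
      change -((a - x) ^ 2 - (b - x) ^ 2) / (8 * H) + (a - b) ^ 2 / (16 * H) = _
      field_simp
      ring
    simp_rw [e1]
    rw [integral_add (hxi.const_mul _) (integrable_const _), integral_const_mul]
    simp only [integral_const, probReal_univ, smul_eq_mul, one_mul]
    change (a - b) / (4 * H) * M.meanReward c s (π c s) + _ = _
    rw [← hb]
    field_simp
    ring
  rw [M.value_congr (r' := fun s a => -(16 * H : ℝ)⁻¹ * (f c s a - g c s a) ^ 2) this,
    value_const_mul]
  field_simp

theorem integral_context (π : C → S → A) (k : C → ℝ) :
    ∫ e, k e.1 ∂M.episodeLaw π = ∑ c, (M.ctxDist c).toReal * k c := by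
  have hk : Measurable fun e : Episode C S A H => k e.1 :=
    (measurable_of_countable k).comp measurable_fst
  rw [M.integral_episodeLaw π hk (B := ∑ c, |k c|) (.of_forall fun e =>
    Finset.single_le_sum (f := fun c => |k c|) (fun _ _ => abs_nonneg _) (Finset.mem_univ e.1))]
  refine Finset.sum_congr rfl fun c _ => ?_
  have := M.isProbabilityMeasure_trajLaw c (π c) H M.s₀
  simp

variable {π : (i : ℕ) → Hist C S A H i → C → S → A}

/-- The least-squares deviation bound for one function and one time. -/
theorem histLaw_sqError_le (hπ : ∀ t, Measurable (π t)) (hH : 0 < H) {f g : C → S → A → ℝ}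
    (hf : ∀ c s a, f c s a ∈ Set.Icc (0 : ℝ) 1) (hg : ∀ c s a, g c s a ∈ Set.Icc (0 : ℝ) 1)
    (hgM : ∀ c s a, s ≠ M.sH → g c s a = M.meanReward c s a) {T : ℕ} (t : Fin T) {ε : ℝ}
    (hε : 0 < ε) :
    M.histLaw π T {hist | 2 * (sqLoss f (hist.pre t) - sqLoss g (hist.pre t)) +
      16 * H * Real.log (1 / ε) <
        ∑ i : Fin t, M.sqError f g (π i ((hist.pre t).pre i))} ≤ ENNReal.ofReal ε := by
  have hH0 : (0 : ℝ) < H := by exact_mod_cast hH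
  have key := M.histLaw_deviation_le hπ
    -- Increments from round `t` on are set to zero, so that a statement about the prefix of length
    -- `t` is bounded directly under the law of `T` episodes.
    (X := fun i _ e => if i < t.val then -(excessLoss f g e) / (8 * H) else 0)
    (v := fun i q => if i < t.val then -(M.sqError f g q) / (16 * H) else 0)
    (fun i q => by
      have := measurable_excessLoss (H := H) f g
      split_ifs <;> fun_prop)
    (fun i q => by
      filter_upwards [M.ae_abs_excessLoss_le q hf hg] with e he
      split_ifs
      · rw [abs_div, abs_neg, abs_of_pos (by positivity : (0 : ℝ) < 8 * H),
          div_le_one (by positivity)]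
        linarith
      · simp)
    (fun i q => by
      split_ifs
      · exact M.integral_excessLoss_moment_le hH q hf hg hgM
      · simp) T hε
  refine (measure_mono fun hist hh => ?_).trans key
  rw [Set.mem_ofPred_eq] at hh ⊢
  have e1 : ∀ i : Fin T, ((if i.val < t.val then -(excessLoss f g (hist i)) / (8 * H) else 0) -
      if i.val < t.val then -(M.sqError f g (π i (hist.pre i))) / (16 * H) else 0) =
      if i.val < t.val then -(excessLoss f g (hist i)) / (8 * H) -
        -(M.sqError f g (π i (hist.pre i))) / (16 * H) else 0 := fun i => by
    split_ifs <;> simp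
  simp_rw [e1]
  rw [sum_ite_lt_eq_sum_castLE t.2.le, Finset.sum_sub_distrib, ← Finset.sum_div, ← Finset.sum_div,
    Finset.sum_neg_distrib, Finset.sum_neg_distrib]
  rw [sqLoss_sub_sqLoss] at hh
  change _ < -(∑ i : Fin t, excessLoss f g (hist.pre t i)) / (8 * H) -
    -(∑ i : Fin t, M.sqError f g (π i ((hist.pre t).pre i))) / (16 * H)
  set U := ∑ i : Fin t, excessLoss f g (hist.pre t i)
  set V := ∑ i : Fin t, M.sqError f g (π i ((hist.pre t).pre i))
  have e2 : -U / (8 * H) - -V / (16 * H) = (V - 2 * U) / (16 * H) := by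
    field_simp; ring
  rw [e2, lt_div_iff₀ (by positivity)]
  linarith

/-- The regret is at most twice the sum of the expected suboptimalities, up to `H log (1/ε)`. -/
theorem histLaw_regret_le (hπ : ∀ t, Measurable (π t)) (hH : 0 < H) {πs : C → S → A}
    (hπs : M.IsOptimal πs) (T : ℕ) {ε : ℝ} (hε : 0 < ε) :
    M.histLaw π T {hist | 2 * ∑ t : Fin T, M.meanGap πs (π t (hist.pre t)) +
      H * Real.log (1 / ε) < M.regret πs π hist} ≤ ENNReal.ofReal ε := by
  have hH0 : (0 : ℝ) < H := by exact_mod_cast hH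
  have hX0 : ∀ q c, 0 ≤ M.gap πs q c / H := fun q c => div_nonneg (M.gap_nonneg hπs q c) hH0.le
  have hX1 : ∀ q c, M.gap πs q c / H ≤ 1 := fun q c => (div_le_one hH0).2 (M.gap_le πs q c)
  have key := M.histLaw_deviation_le hπ
    (X := fun _ q e => M.gap πs q e.1 / H) (v := fun _ q => 2 * M.meanGap πs q / H)
    (fun i q => (measurable_of_countable fun c => M.gap πs q c / H).comp measurable_fst)
    (fun i q => .of_forall fun e => by
      rw [abs_of_nonneg (hX0 _ _)]
      exact hX1 _ _)
    (fun i q => by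
      rw [M.integral_context q fun c => M.gap πs q c / H + (M.gap πs q c / H) ^ 2, meanGap,
        Finset.mul_sum, Finset.sum_div]
      refine Finset.sum_le_sum fun c _ => ?_
      -- Scaled gaps lie in `[0, 1]`, so their squares are dominated by themselves: twice the mean
      -- suffices for `v`, with no square-root deviation term.
      have h1 : (M.gap πs q c / H) ^ 2 ≤ M.gap πs q c / H := by
        rw [sq]
        exact mul_le_of_le_one_left (hX0 _ _) (hX1 _ _)
      calc _ ≤ (M.ctxDist c).toReal * (2 * (M.gap πs q c / H)) :=
            mul_le_mul_of_nonneg_left (by linarith) ENNReal.toReal_nonneg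
        _ = _ := by ring) T hε
  refine (measure_mono fun hist hh => ?_).trans key
  rw [Set.mem_ofPred_eq] at hh ⊢
  rw [Finset.sum_sub_distrib, ← Finset.sum_div, ← Finset.sum_div, ← Finset.mul_sum, ← sub_div,
    lt_div_iff₀ hH0]
  change _ < M.regret πs π hist - _
  linarith

end LayeredCMDP

/-! ### Numerical estimates for logarithms and `beta` -/

section Numeric

/-- Keeping the logarithm away from 0 lets constants and `log T` be absorbed into multiples of it.
-/
theorem half_le_log_two_mul {n : ℕ} (hn : 1 ≤ n) {δ : ℝ} (hδ : 0 < δ) (hδ1 : δ < 1) :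
    1 / 2 ≤ Real.log (2 * n / δ) := by
  have h1 : (1 : ℝ) ≤ n := by exact_mod_cast hn
  have : Real.log 2 ≤ Real.log (2 * n / δ) := by
    refine Real.log_le_log (by norm_num) ?_
    rw [le_div_iff₀ hδ]
    nlinarith
  linarith [Real.log_two_gt_d9]

theorem log_loss_confidence_le {n T : ℕ} (hn : 1 ≤ n) (hT : 1 ≤ T) {δ : ℝ} (hδ : 0 < δ)
    (hδ1 : δ < 1) :
    Real.log (1 / (δ / (2 * n * T))) ≤ 2 * (1 + Real.log T) * Real.log (2 * n / δ) := by
  have h1 : (1 : ℝ) ≤ n := by exact_mod_cast hn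
  have h2 : (1 : ℝ) ≤ T := by exact_mod_cast hT
  have e : 1 / (δ / (2 * n * T)) = (2 * n / δ) * T := by field_simp
  rw [e, Real.log_mul (by positivity) (by positivity)]
  have h3 := half_le_log_two_mul hn hδ hδ1
  have h4 := Real.log_nonneg h2
  nlinarith

theorem le_beta {n s a : ℕ} (hn : 1 ≤ n) {δ : ℝ} (hδ : 0 < δ) {t : ℕ} (ht : 1 ≤ t) :
    4 * Real.sqrt (t * Real.log (2 * n / δ) / (s * a)) ≤ beta n s a δ t := by
  have h1 : (1 : ℝ) ≤ n := by exact_mod_cast hn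
  have h2 : (1 : ℝ) ≤ t := by exact_mod_cast ht
  have h3 : Real.log (2 * n / δ) ≤ Real.log (4 * n * (t : ℝ) ^ 3 / δ) := by
    refine Real.log_le_log (by positivity) ?_
    gcongr ?_ / _
    nlinarith [one_le_pow₀ h2 (n := 3)]
  by_cases h4 : 0 ≤ Real.log (2 * n / δ)
  · have : (4 : ℝ) = Real.sqrt 16 := by
      rw [show (16 : ℝ) = 4 ^ 2 by norm_num, Real.sqrt_sq (by norm_num)]
    rw [this, ← Real.sqrt_mul (by norm_num)]
    refine Real.sqrt_le_sqrt ?_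
    rw [← mul_div_assoc]
    gcongr ?_ / _
    nlinarith
  -- Without `δ < 1` the logarithm may be negative; the square root is then 0 by convention.
  · rw [Real.sqrt_eq_zero_of_nonpos, mul_zero]
    · exact Real.sqrt_nonneg _
    · exact div_nonpos_of_nonpos_of_nonneg
        (mul_nonpos_of_nonneg_of_nonpos (by positivity) (not_le.1 h4).le) (by positivity)

theorem beta_le {n s a : ℕ} (hn : 1 ≤ n) {δ : ℝ} (hδ : 0 < δ) (hδ1 : δ < 1) {t T : ℕ}
    (ht : 1 ≤ t) (htT : t ≤ T) :
    beta n s a δ t ≤ 11 * (1 + Real.log T) * Real.sqrt (T * Real.log (2 * n / δ) / (s * a)) := by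
  have h1 : (1 : ℝ) ≤ n := by exact_mod_cast hn
  have h2 : (1 : ℝ) ≤ t := by exact_mod_cast ht
  have h3 : (t : ℝ) ≤ T := by exact_mod_cast htT
  have h4 := half_le_log_two_mul hn hδ hδ1
  have h5 : Real.log t ≤ Real.log T := Real.log_le_log (by positivity) h3
  have h6 := Real.log_nonneg h2
  have h7 : Real.log (4 * n * (t : ℝ) ^ 3 / δ) =
      Real.log 2 + Real.log (2 * n / δ) + 3 * Real.log t := by
    rw [show 4 * n * (t : ℝ) ^ 3 / δ = 2 * (2 * n / δ) * (t : ℝ) ^ 3 by ring,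
      Real.log_mul (by positivity) (by positivity), Real.log_mul (by norm_num) (by positivity),
      Real.log_pow]
    norm_num
  have h8 : Real.log 2 ≤ Real.log (2 * n / δ) := by
    refine Real.log_le_log (by norm_num) ?_
    rw [le_div_iff₀ hδ]
    nlinarith
  set l := Real.log (2 * n / δ)
  set u := Real.log T
  -- Uses `log 2 ≤ l` and `1 ≤ 2 l`. With the factor 17 in `beta` this gives `17 · 6 = 102 ≤ 11²`.
  have h9 : Real.log (4 * n * (t : ℝ) ^ 3 / δ) ≤ 6 * (1 + u) * l := by
    rw [h7]
    nlinarith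
  have h10 : (0 : ℝ) ≤ 11 * (1 + u) := by linarith
  rw [← Real.sqrt_sq h10, ← Real.sqrt_mul (sq_nonneg _)]
  refine Real.sqrt_le_sqrt ?_
  rw [← mul_div_assoc]
  gcongr ?_ / _
  have h11 : 0 ≤ Real.log (4 * n * (t : ℝ) ^ 3 / δ) := by
    rw [h7]
    linarith [Real.log_nonneg one_le_two]
  calc 17 * (t : ℝ) * Real.log (4 * n * (t : ℝ) ^ 3 / δ) ≤ 17 * T * (6 * (1 + u) * l) := by gcongr
    _ = T * (102 * ((1 + u) * l)) := by ring
    _ ≤ T * (121 * ((1 + u) ^ 2 * l)) := by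
        gcongr
        · norm_num
        · nlinarith
    _ = _ := by ring

theorem sum_inv_sqrt_le (T : ℕ) :
    ∑ t ∈ Finset.range T, (Real.sqrt ((t + 1 : ℕ) : ℝ))⁻¹ ≤ 2 * Real.sqrt T := by
  induction T with
  | zero => simp
  | succ T ih =>
    rw [Finset.sum_range_succ]
    refine (add_le_add_left ih _).trans ?_
    have h1 : 0 < Real.sqrt ((T + 1 : ℕ) : ℝ) := Real.sqrt_pos.2 (by positivity)
    have h2 := Real.sq_sqrt (show (0 : ℝ) ≤ ((T + 1 : ℕ) : ℝ) by positivity)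
    have h3 := Real.sq_sqrt (show (0 : ℝ) ≤ (T : ℝ) by positivity)
    have h4 := Real.sqrt_nonneg (T : ℝ)
    push_cast at h1 h2 ⊢
    set x := Real.sqrt (T : ℝ)
    set y := Real.sqrt ((T : ℝ) + 1)
    have h5 : y⁻¹ * y = 1 := inv_mul_cancel₀ h1.ne'
    have : (2 * x + y⁻¹) * y ≤ (2 * y) * y := by
      nlinarith [sq_nonneg (x - y)]
    exact le_of_mul_le_mul_right this h1

end Numeric

/-! ### Optimism and the sum of the bonuses -/

namespace LayeredCMDP

variable {C S A : Type*} {H : ℕ} (M : LayeredCMDP C S A H)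
variable [Fintype C] [Fintype S] [Fintype A]
  [MeasurableSpace C] [DiscreteMeasurableSpace C] [MeasurableSpace S]
  [DiscreteMeasurableSpace S] [MeasurableSpace A] [DiscreteMeasurableSpace A]

/-- A policy that is optimal for the optimistic rewards is suboptimal by at most twice its expected
bonus plus the squared error along the past policies. -/
theorem meanGap_le_of_optimistic {t : ℕ} {past : Fin t → C → S → A} {f g : C → S → A → ℝ}
    (hgM : ∀ c s a, s ≠ M.sH → g c s a = M.meanReward c s a) {b : ℝ} (hb : 0 < b)
    (hw : ∀ c s a, s ≠ M.sH → 0 < M.weight past c s a) {π : C → S → A}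
    (hπ : ∀ c (q : S → A), value H (M.P c) M.s₀ (optReward M f b past c) q ≤
      value H (M.P c) M.s₀ (optReward M f b past c) (π c)) (πs : C → S → A) :
    M.meanGap πs π ≤ 2 * b * ∑ c, (M.ctxDist c).toReal *
        value H (M.P c) M.s₀ (fun s a => (M.weight past c s a)⁻¹) (π c) +
      (2 * b)⁻¹ * ∑ i, M.sqError f g (past i) := by
  have hc : ∀ c, M.gap πs π c ≤
      2 * b * value H (M.P c) M.s₀ (fun s a => (M.weight past c s a)⁻¹) (π c) +
      (2 * b)⁻¹ * ∑ i, value H (M.P c) M.s₀ (fun s a => (f c s a - g c s a) ^ 2) (past i c) := by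
    intro c
    have h1 := M.value_le_value_add_bonus past (f := g c) (g := f c) hb (hw c) (πs c)
    have h2 := M.value_le_value_add_bonus past (f := f c) (g := g c) hb (hw c) (π c)
    -- The bonus along `πs` in `h1` is cancelled here and reappears as a second bonus along `π`.
    have h3 := hπ c (πs c)
    simp only [optReward_eq, value_add, value_const_mul] at h3
    have h4 : ∀ q : S → A, M.trueValue c q = value H (M.P c) M.s₀ (g c) q := fun q =>
      (M.value_congr fun s hs => hgM c s _ hs).symm
    have h5 : (2 * b)⁻¹ = 2 * (4 * b)⁻¹ := by field_simp; norm_num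
    simp_rw [sub_sq_comm (g c _ _)] at h1
    rw [gap, h4, h4, h5]
    linarith
  calc M.meanGap πs π ≤ ∑ c, (M.ctxDist c).toReal *
      (2 * b * value H (M.P c) M.s₀ (fun s a => (M.weight past c s a)⁻¹) (π c) +
      (2 * b)⁻¹ * ∑ i, value H (M.P c) M.s₀ (fun s a => (f c s a - g c s a) ^ 2) (past i c)) :=
        Finset.sum_le_sum fun c _ => mul_le_mul_of_nonneg_left (hc c) ENNReal.toReal_nonneg
    _ = _ := by
        unfold sqError
        rw [Finset.sum_comm (s := (Finset.univ : Finset (Fin t))), Finset.mul_sum, Finset.mul_sum,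
          ← Finset.sum_add_distrib]
        refine Finset.sum_congr rfl fun c _ => ?_
        rw [← Finset.mul_sum]
        ring

/-- The bonuses collected over `T` rounds. -/
theorem sum_bonus_le {p : ℝ} (hp : 0 < p) (hM : M.MinReach p) {T : ℕ}
    (π : (i : ℕ) → C → S → A)
    (hcount : ∀ t < T, Fintype.card A ≤ t → ∀ c s a,
      0 < playCount (fun i : Fin t => π i) c s a) (c : C) :
    ∑ t ∈ (Finset.range T).filter (fun t => Fintype.card A ≤ t), value H (M.P c) M.s₀
      (fun s a => (M.weight (fun i : Fin t => π i) c s a)⁻¹) (π t c) ≤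
      p⁻¹ * (Fintype.card S * (Fintype.card A * (1 + Real.log T))) := by
  classical
  -- Visiting probabilities are bounded by 1 and weights below by `p` times counts, which leaves a
  -- separate counting problem for each state.
  have h1 : ∀ t ∈ (Finset.range T).filter (fun t => Fintype.card A ≤ t), value H (M.P c) M.s₀
      (fun s a => (M.weight (fun i : Fin t => π i) c s a)⁻¹) (π t c) ≤
      p⁻¹ * ∑ s, ((((Finset.range t).filter fun i => π i c s = π t c s).card : ℝ))⁻¹ := by
    intro t ht
    rw [value_eq_sum_collectProb, Finset.mul_sum]
    refine Finset.sum_le_sum fun s _ => ?_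
    by_cases hs : s = M.sH
    · rw [hs, M.collectProb_sH, zero_mul]; positivity
    have hcard : ((Finset.range t).filter fun i => π i c s = π t c s).card =
        playCount (fun i : Fin t => π i) c s (π t c s) := by
      unfold playCount
      rw [Finset.card_filter, Finset.card_filter, Finset.sum_range]
    rw [hcard]
    have hpos : (0 : ℝ) < playCount (fun i : Fin t => π i) c s (π t c s) := by
      exact_mod_cast hcount t (Finset.mem_range.1 (Finset.mem_filter.1 ht).1)
        (Finset.mem_filter.1 ht).2 c s _
    have hw := hM.playCount_le_weight (fun i : Fin t => π i) (c := c) hs (π t c s)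
    have hw' : (M.weight (fun i : Fin t => π i) c s (π t c s))⁻¹ ≤
        p⁻¹ * (playCount (fun i : Fin t => π i) c s (π t c s) : ℝ)⁻¹ := by
      rw [← mul_inv]
      exact inv_anti₀ (mul_pos hp hpos) hw
    refine (mul_le_of_le_one_left ?_ (M.collectProb_le_one _ _ _)).trans hw'
    exact inv_nonneg.2 (M.weight_nonneg _ hs _)
  refine (Finset.sum_le_sum h1).trans ?_
  rw [← Finset.mul_sum]
  refine mul_le_mul_of_nonneg_left ?_ (inv_nonneg.2 hp.le)
  refine (Finset.sum_le_sum_of_subset_of_nonneg (Finset.filter_subset _ _)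
    fun _ _ _ => by positivity).trans ?_
  rw [Finset.sum_comm]
  refine (Finset.sum_le_card_nsmul _ _ _ fun s _ => sum_inv_count_le (fun t => π t c s) T).trans ?_
  rw [nsmul_eq_mul, Finset.card_univ]

end LayeredCMDP

/-! ### The regret of RM-KD -/

namespace RMKD

variable {C S A : Type*} {H : ℕ} {M : LayeredCMDP C S A H}
variable [Fintype C] [Fintype S] [Fintype A]
  [MeasurableSpace C] [DiscreteMeasurableSpace C] [MeasurableSpace S]
  [DiscreteMeasurableSpace S] [MeasurableSpace A] [DiscreteMeasurableSpace A]
variable {F : Finset (C → S → A → ℝ)}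

/-- The initial rounds play every action once in every state and context; this makes the weights
positive, as the AM-GM step requires. -/
theorem playCount_pos {β : ℕ → ℝ} (alg : RMKD M F β) {t : ℕ} (ht : Fintype.card A ≤ t)
    (hist : Hist C S A H t) (c : C) (s : S) (a : A) :
    0 < LayeredCMDP.playCount (fun i : Fin t => alg.policy i (hist.pre i)) c s a := by
  classical
  unfold LayeredCMDP.playCount
  rw [Finset.card_pos]
  refine ⟨⟨alg.order.symm a, (alg.order.symm a).2.trans_le ht⟩, Finset.mem_filter.2
    ⟨Finset.mem_univ _, ?_⟩⟩
  change alg.policy (alg.order.symm a) _ c s = a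
  rw [alg.policy_init _ (alg.order.symm a).2]
  simp

/-- The sum of the expected suboptimalities on the event that the least-squares estimates are
accurate. -/
theorem sum_meanGap_le {p δ : ℝ} {T : ℕ} {πs : C → S → A} {g : C → S → A → ℝ}
    (alg : RMKD M F (beta F.card (Fintype.card S) (Fintype.card A) δ))
    (hp : 0 < p) (hM : M.MinReach p) (hgF : g ∈ F)
    (hgM : ∀ c s a, s ≠ M.sH → g c s a = M.meanReward c s a)
    (hδ : 0 < δ) (hδ1 : δ < 1) (hT : 1 ≤ T) (hS : 0 < Fintype.card S) (hA : 0 < Fintype.card A)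
    (hist : Hist C S A H T)
    (hls : ∀ t : Fin T, ∀ f ∈ F, ∑ i : Fin t, M.sqError f g (alg.policy i ((hist.pre t).pre i)) ≤
      2 * (sqLoss f (hist.pre t) - sqLoss g (hist.pre t)) +
        16 * H * Real.log (1 / (δ / (2 * F.card * T)))) :
    ∑ t : Fin T, M.meanGap πs (alg.policy t (hist.pre t)) ≤
      Fintype.card A * H + (22 * (1 + Real.log T) ^ 2 * p⁻¹ + 8 * (1 + Real.log T) * H) *
        Real.sqrt (T * Fintype.card S * Fintype.card A * Real.log (2 * F.card / δ)) := by
  have hn : 1 ≤ F.card := Finset.card_pos.2 ⟨g, hgF⟩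
  have hΛ := log_loss_confidence_le hn hT hδ hδ1
  have hl := half_le_log_two_mul hn hδ hδ1
  set l := Real.log (2 * F.card / δ) with hl_def
  set N : ℝ := (Fintype.card S : ℝ) * Fintype.card A with hN_def
  have hT' : (1 : ℝ) ≤ T := by exact_mod_cast hT
  set u := 1 + Real.log T with hu_def
  have hu : 1 ≤ u := by linarith [Real.log_nonneg hT']
  have hN : 0 < N := by positivity
  -- In this unit `beta` at `t + 1` lies between `4 √(t+1) ρ` and `11 u √T ρ`, and the target rate
  -- is `√T N ρ`.
  set ρ := Real.sqrt (l / N) with hρ_def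
  have hρ : 0 < ρ := Real.sqrt_pos.2 (by positivity)
  have hρ2 : ρ ^ 2 * N = l := by
    rw [hρ_def, Real.sq_sqrt (by positivity)]; field_simp
  have hsq : ∀ x : ℝ, 0 ≤ x → Real.sqrt (x * l / N) = Real.sqrt x * ρ := fun x hx => by
    rw [mul_div_assoc, Real.sqrt_mul hx]
  have hR : Real.sqrt (T * Fintype.card S * Fintype.card A * l) = Real.sqrt T * (N * ρ) := by
    rw [← hρ2, show (T : ℝ) * Fintype.card S * Fintype.card A * (ρ ^ 2 * N) =
      T * (N * ρ) ^ 2 by rw [hN_def]; ring, Real.sqrt_mul (by positivity),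
      Real.sqrt_sq (by positivity)]
  rw [hR]
  -- The played policies as a sequence on `ℕ`; the values from `T` on are irrelevant.
  set q : ℕ → C → S → A := fun i => if h : i < T then alg.policy i (hist.pre ⟨i, h⟩) else πs
    with hq_def
  have hq : ∀ t : Fin T, q t = alg.policy t (hist.pre t) := fun t => by
    simp [hq_def]
  have hpast : ∀ t : Fin T, (fun i : Fin t => q i) =
      fun i : Fin t => alg.policy i ((hist.pre t).pre i) := fun t => by
    funext i
    exact hq ⟨i, i.2.trans t.2⟩
  have hcount : ∀ t < T, Fintype.card A ≤ t → ∀ c s a,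
      0 < LayeredCMDP.playCount (fun i : Fin t => q i) c s a := fun t ht hAt c s a => by
    rw [hpast ⟨t, ht⟩]
    exact alg.playCount_pos hAt _ c s a
  set V : ℕ → C → ℝ := fun t c => value H (M.P c) M.s₀
    (fun s a => (M.weight (fun i : Fin t => q i) c s a)⁻¹) (q t c) with hV_def
  have hV0 : ∀ t c, 0 ≤ V t c := fun t c =>
    M.value_nonneg fun s hs => inv_nonneg.2 (M.weight_nonneg _ hs _)
  have hround : ∀ t ∈ (Finset.range T).filter (fun t => Fintype.card A ≤ t),
      M.meanGap πs (q t) ≤ 2 * (11 * u * (Real.sqrt T * ρ)) *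
          ∑ c, (M.ctxDist c).toReal * V t c +
        4 * H * u * (N * ρ) * (Real.sqrt ((t + 1 : ℕ) : ℝ))⁻¹ := by
    intro t ht
    obtain ⟨htT, hAt⟩ := Finset.mem_filter.1 ht
    rw [Finset.mem_range] at htT
    have hlow : 4 * (Real.sqrt ((t + 1 : ℕ) : ℝ) * ρ) ≤
        beta F.card (Fintype.card S) (Fintype.card A) δ (t + 1) := by
      rw [← hsq _ (by positivity)]
      exact le_beta hn hδ (by omega)
    have hup : beta F.card (Fintype.card S) (Fintype.card A) δ (t + 1) ≤
        11 * u * (Real.sqrt T * ρ) := by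
      rw [← hsq _ (by positivity)]
      exact beta_le hn hδ hδ1 (by omega) (by omega)
    have hτ : 0 < Real.sqrt ((t + 1 : ℕ) : ℝ) := Real.sqrt_pos.2 (by positivity)
    have hb : 0 < beta F.card (Fintype.card S) (Fintype.card A) δ (t + 1) :=
      lt_of_lt_of_le (by positivity) hlow
    have hopt := alg.policy_opt t hAt (hist.pre ⟨t, htT⟩)
    have hp1 := hpast ⟨t, htT⟩
    have hq1 := hq ⟨t, htT⟩
    simp only at hp1 hq1
    rw [← hp1, ← hq1] at hopt
    have h1 := M.meanGap_le_of_optimistic hgM hb (fun c s a hs => by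
      have h0 : (0 : ℝ) < LayeredCMDP.playCount (fun i : Fin t => q i) c s a := by
        exact_mod_cast hcount t htT hAt c s a
      exact lt_of_lt_of_le (mul_pos hp h0) (hM.playCount_le_weight _ hs a)) hopt πs
    have h2 := hls ⟨t, htT⟩ _ (alg.fhat_mem t hAt (hist.pre ⟨t, htT⟩))
    -- Minimality of the estimate makes the loss difference in `h2` nonpositive.
    have h3 := alg.fhat_le t hAt (hist.pre ⟨t, htT⟩) g hgF
    have h4 : ∑ i : Fin t, M.sqError (alg.fhat t (hist.pre ⟨t, htT⟩)) g (q i) ≤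
        16 * H * (2 * u * l) := by
      have e : ∑ i : Fin t, M.sqError (alg.fhat t (hist.pre ⟨t, htT⟩)) g (q i) =
          ∑ i : Fin t, M.sqError (alg.fhat t (hist.pre ⟨t, htT⟩)) g
            (alg.policy i ((hist.pre ⟨t, htT⟩).pre i)) :=
        Finset.sum_congr rfl fun i _ => by rw [← congrFun hp1 i]
      rw [e]
      refine h2.trans ?_
      have : 16 * H * Real.log (1 / (δ / (2 * F.card * T))) ≤ 16 * H * (2 * u * l) := by gcongr
      simp only at this ⊢
      linarith
    -- The upper bound on `beta` serves the bonus term, the lower bound the error term, where `beta`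
    -- is in the denominator.
    refine h1.trans (add_le_add ?_ ?_)
    · have : 0 ≤ ∑ c, (M.ctxDist c).toReal * V t c :=
        Finset.sum_nonneg fun c _ => mul_nonneg ENNReal.toReal_nonneg (hV0 t c)
      gcongr
    · calc _ ≤ (2 * beta F.card (Fintype.card S) (Fintype.card A) δ (t + 1))⁻¹ *
            (16 * H * (2 * u * l)) := by gcongr
        _ ≤ (2 * (4 * (Real.sqrt ((t + 1 : ℕ) : ℝ) * ρ)))⁻¹ * (16 * H * (2 * u * l)) := by gcongr
        _ = _ := by
          rw [← hρ2]
          field_simp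
          norm_num
  have hsum : ∑ t : Fin T, M.meanGap πs (alg.policy t (hist.pre t)) =
      ∑ t ∈ Finset.range T, M.meanGap πs (q t) := by
    rw [Finset.sum_range]
    exact Finset.sum_congr rfl fun t _ => by rw [hq]
  rw [hsum, ← Finset.sum_filter_add_sum_filter_not _ (fun t => Fintype.card A ≤ t), add_comm]
  refine add_le_add ?_ ?_
  · refine (Finset.sum_le_card_nsmul _ _ (H : ℝ) fun t _ => M.meanGap_le _ _).trans ?_
    rw [nsmul_eq_mul]
    gcongr
    calc _ ≤ (Finset.range (Fintype.card A)).card := Finset.card_le_card fun t ht => by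
          simpa using (Finset.mem_filter.1 ht).2
      _ = _ := Finset.card_range _
  · refine (Finset.sum_le_sum hround).trans ?_
    rw [Finset.sum_add_distrib, ← Finset.mul_sum, ← Finset.mul_sum, Finset.sum_comm]
    have h1 : ∑ c, ∑ t ∈ (Finset.range T).filter (fun t => Fintype.card A ≤ t),
        (M.ctxDist c).toReal * V t c ≤ p⁻¹ * (N * u) := by
      calc _ ≤ ∑ c, (M.ctxDist c).toReal * (p⁻¹ * (N * u)) := by
            refine Finset.sum_le_sum fun c _ => ?_
            rw [← Finset.mul_sum]
            refine mul_le_mul_of_nonneg_left ?_ ENNReal.toReal_nonneg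
            refine (M.sum_bonus_le hp hM q hcount c).trans (le_of_eq ?_)
            rw [hN_def]
            ring
        _ = _ := by rw [← Finset.sum_mul, M.sum_ctxDist, one_mul]
    have h2 : ∑ t ∈ (Finset.range T).filter (fun t => Fintype.card A ≤ t),
        (Real.sqrt ((t + 1 : ℕ) : ℝ))⁻¹ ≤ 2 * Real.sqrt T :=
      (Finset.sum_le_sum_of_subset_of_nonneg (Finset.filter_subset _ _)
        fun _ _ _ => by positivity).trans (sum_inv_sqrt_le T)
    have hu0 : 0 ≤ u := by linarith
    calc _ ≤ 2 * (11 * u * (Real.sqrt T * ρ)) * (p⁻¹ * (N * u)) +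
          4 * H * u * (N * ρ) * (2 * Real.sqrt T) := by gcongr
      _ = _ := by ring

/-- The regret bound of RM-KD for a general class. -/
theorem regret_bound {p δ : ℝ} {T : ℕ} {πs : C → S → A}
    (alg : RMKD M F (beta F.card (Fintype.card S) (Fintype.card A) δ))
    (hp : 0 < p) (hM : M.MinReach p)
    (hF : ∀ f ∈ F, ∀ c s a, f c s a ∈ Set.Icc (0 : ℝ) 1) (hreal : M.Realizable F)
    (hδ : 0 < δ) (hδ1 : δ < 1) (hT : 1 ≤ T) (hπs : M.IsOptimal πs) :
    ENNReal.ofReal (1 - δ) ≤ M.histLaw alg.policy T {hist | M.regret πs alg.policy hist ≤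
      44 * (1 + Real.log T) ^ 2 * ((1 / p + H) * Real.sqrt (T * Fintype.card S * Fintype.card A *
        Real.log (2 * F.card / δ)) + Fintype.card A * H)} := by
  have hprob := M.isProbabilityMeasure_histLaw alg.measurable_policy T
  obtain ⟨g, hgF, hgM⟩ := hreal
  have hn : 1 ≤ F.card := Finset.card_pos.2 ⟨g, hgF⟩
  have hT' : (1 : ℝ) ≤ T := by exact_mod_cast hT
  have hn' : (1 : ℝ) ≤ F.card := by exact_mod_cast hn
  have hl := half_le_log_two_mul hn hδ hδ1
  have hu : 1 ≤ 1 + Real.log T := by linarith [Real.log_nonneg hT']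
  obtain ⟨c₀, -⟩ := M.ctxDist.support_nonempty
  have hS : 0 < Fintype.card S := Fintype.card_pos_iff.2 ⟨M.s₀⟩
  have hA : 0 < Fintype.card A := Fintype.card_pos_iff.2 ⟨πs c₀ M.s₀⟩
  set R := Real.sqrt (T * Fintype.card S * Fintype.card A * Real.log (2 * F.card / δ)) with hR_def
  have hR0 : 0 ≤ R := Real.sqrt_nonneg _
  have hTR : Real.sqrt (T * Real.log (2 * F.card / δ)) ≤ R := by
    refine Real.sqrt_le_sqrt ?_
    have h1 : (1 : ℝ) ≤ Fintype.card S := by exact_mod_cast hS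
    have h2 : (1 : ℝ) ≤ Fintype.card A := by exact_mod_cast hA
    have h3 : 0 ≤ (T : ℝ) * Real.log (2 * F.card / δ) := by positivity
    calc _ ≤ (T * Real.log (2 * F.card / δ)) * (Fintype.card S * Fintype.card A) :=
          le_mul_of_one_le_right h3 (one_le_mul_of_one_le_of_one_le h1 h2)
      _ = _ := by ring
  set u := 1 + Real.log (T : ℝ)
  have hu2 : 1 ≤ u ^ 2 := one_le_pow₀ hu
  have hHR : 0 ≤ (H : ℝ) * R := by positivity
  have hAH : 0 ≤ (Fintype.card A : ℝ) * H := by positivity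
  have hpR : 0 ≤ 1 / p * R := by positivity
  have hbound : ∀ x : ℝ, x ≤ H * R → x ≤ 44 * u ^ 2 * ((1 / p + H) * R + Fintype.card A * H) := by
    intro x hx
    nlinarith
  have htriv : ∀ hist : Hist C S A H T, M.regret πs alg.policy hist ≤ T * H := fun hist => by
    refine (Finset.sum_le_card_nsmul _ _ (H : ℝ) fun t _ => M.gap_le πs _ _).trans ?_
    simp
  have hall : (∀ hist : Hist C S A H T, M.regret πs alg.policy hist ≤ H * R) →
      ENNReal.ofReal (1 - δ) ≤ M.histLaw alg.policy T {hist | M.regret πs alg.policy hist ≤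
        44 * u ^ 2 * ((1 / p + H) * R + Fintype.card A * H)} := fun h => by
    rw [Set.eq_univ_of_forall (s := {hist | M.regret πs alg.policy hist ≤
      44 * u ^ 2 * ((1 / p + H) * R + Fintype.card A * H)}) fun hist => hbound _ (h hist),
      measure_univ]
    exact ENNReal.ofReal_le_one.2 (by linarith)
  -- The deviation bounds divide by `H`.
  rcases Nat.eq_zero_or_pos H with hH | hH
  · refine hall fun hist => (htriv hist).trans ?_
    subst hH
    simp
  have hH0 : (0 : ℝ) < H := by exact_mod_cast hH
  -- If `T < l`, the trivial bound `T H ≤ H √(T l)` suffices; otherwise `l ≤ √(T l)`, which absorbs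
  -- the term `H log (2/δ)`.
  by_cases hlT : (T : ℝ) < Real.log (2 * F.card / δ)
  · refine hall fun hist => (htriv hist).trans ?_
    rw [mul_comm]
    gcongr
    refine le_trans ?_ hTR
    exact Real.le_sqrt_of_sq_le (by nlinarith)
  rw [not_lt] at hlT
  -- Half of `δ` is shared by the `|F| T` least-squares events, the other half goes to the regret
  -- event.
  set ε := δ / (2 * F.card * T) with hε_def
  have hε : 0 < ε := by positivity
  set bad₁ : Fin T → (C → S → A → ℝ) → Set (Hist C S A H T) := fun t f =>
    {hist | 2 * (sqLoss f (hist.pre t) - sqLoss g (hist.pre t)) + 16 * H * Real.log (1 / ε) <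
      ∑ i : Fin t, M.sqError f g (alg.policy i ((hist.pre t).pre i))}
  set bad₂ : Set (Hist C S A H T) :=
    {hist | 2 * ∑ t : Fin T, M.meanGap πs (alg.policy t (hist.pre t)) +
      H * Real.log (1 / (δ / 2)) < M.regret πs alg.policy hist}
  set good : Set (Hist C S A H T) := {hist | M.regret πs alg.policy hist ≤
    44 * u ^ 2 * ((1 / p + H) * R + Fintype.card A * H)}
  -- Subadditivity applied to a cover, rather than complements, needs no measurability of these
  -- sets.
  have hcover : Set.univ ⊆ good ∪ ((⋃ t, ⋃ f ∈ F, bad₁ t f) ∪ bad₂) := by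
    intro hist _
    by_contra hcon
    simp only [Set.mem_union, Set.mem_iUnion, not_or, not_exists] at hcon
    obtain ⟨h1, h2, h3⟩ := hcon
    refine h1 ?_
    have hls := alg.sum_meanGap_le (πs := πs) hp hM hgF hgM hδ hδ1 hT hS hA hist
      fun t f hf => not_lt.1 (h2 t f hf)
    have hreg : M.regret πs alg.policy hist ≤ _ := not_lt.1 h3
    change M.regret πs alg.policy hist ≤ 44 * u ^ 2 * ((1 / p + H) * R + Fintype.card A * H)
    have hlog : Real.log (1 / (δ / 2)) ≤ R := by
      refine le_trans ?_ hTR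
      refine le_trans (b := Real.log (2 * F.card / δ)) ?_ ?_
      · refine Real.log_le_log (by positivity) ?_
        rw [one_div_div]
        gcongr
        linarith
      · exact Real.le_sqrt_of_sq_le (by nlinarith)
    have hlog' := mul_le_mul_of_nonneg_left hlog hH0.le
    have hu3 : u ≤ u ^ 2 := by nlinarith
    have e1 := mul_le_mul_of_nonneg_right hu3 hHR
    have e2 := mul_le_mul_of_nonneg_right hu2 hHR
    have e3 := mul_le_mul_of_nonneg_right hu2 hAH
    rw [one_div] at hpR ⊢
    change _ ≤ _ + (22 * u ^ 2 * p⁻¹ + 8 * u * H) * R at hls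
    nlinarith
  have hb₁ : M.histLaw alg.policy T (⋃ t, ⋃ f ∈ F, bad₁ t f) ≤ ENNReal.ofReal (δ / 2) := by
    calc _ ≤ ∑ t : Fin T, ∑ f ∈ F, ENNReal.ofReal ε := by
          refine (measure_iUnion_fintype_le _ _).trans (Finset.sum_le_sum fun t _ => ?_)
          refine (measure_biUnion_finset_le _ _).trans (Finset.sum_le_sum fun f hf => ?_)
          exact M.histLaw_sqError_le alg.measurable_policy hH (hF f hf) (hF g hgF) hgM t hε
      _ = ENNReal.ofReal (T * (F.card * ε)) := by
          rw [ENNReal.ofReal_mul (by positivity), ENNReal.ofReal_mul (by positivity)]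
          simp
      _ = _ := by
          congr 1
          rw [hε_def]
          field_simp
  have hb₂ : M.histLaw alg.policy T bad₂ ≤ ENNReal.ofReal (δ / 2) :=
    M.histLaw_regret_le alg.measurable_policy hH hπs T (by positivity)
  have htot : (1 : ENNReal) ≤ M.histLaw alg.policy T good + ENNReal.ofReal δ := by
    calc 1 = M.histLaw alg.policy T Set.univ := measure_univ.symm
      _ ≤ _ := measure_mono hcover
      _ ≤ _ := measure_union_le _ _
      _ ≤ _ := add_le_add_right (measure_union_le _ _) _
      _ ≤ M.histLaw alg.policy T good + (ENNReal.ofReal (δ / 2) + ENNReal.ofReal (δ / 2)) :=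
          add_le_add_right (add_le_add hb₁ hb₂) _
      _ = _ := by rw [← ENNReal.ofReal_add (by positivity) (by positivity), add_halves]
  rw [ENNReal.ofReal_sub _ hδ.le, ENNReal.ofReal_one]
  exact tsub_le_iff_right.2 htot

end RMKD

/-! ### The product class and the final form of the bounds -/

theorem card_powClass_le {C S A : Type*} [Fintype S] (G : Finset (C → A → ℝ)) :
    (powClass (S := S) G).card ≤ G.card ^ Fintype.card S := by
  classical
  unfold powClass
  refine Finset.card_image_le.trans ?_
  rw [Fintype.card_piFinset]
  simp

theorem powClass_mem_Icc {C S A : Type*} [Fintype S] {G : Finset (C → A → ℝ)}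
    (hG : ∀ g ∈ G, ∀ c a, g c a ∈ Set.Icc (0 : ℝ) 1) :
    ∀ f ∈ powClass (S := S) G, ∀ c s a, f c s a ∈ Set.Icc (0 : ℝ) 1 := by
  classical
  intro f hf c s a
  unfold powClass at hf
  obtain ⟨g, hg, rfl⟩ := Finset.mem_image.1 hf
  exact hG _ (Fintype.mem_piFinset.1 hg s) c a

/-- From `|G^S| ≤ |G|^|S|` and `2/δ ≤ (2/δ)^|S|` the logarithm grows at most by the factor `|S|`,
which joins the `|S|` already under the root. -/
theorem sqrt_log_powClass_le {C S A : Type*} [Fintype S] [Nonempty S] {G : Finset (C → A → ℝ)}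
    (hG : (powClass (S := S) G).Nonempty) {δ : ℝ} (hδ : 0 < δ) (hδ1 : δ < 1) (T a : ℕ) :
    Real.sqrt (T * Fintype.card S * a * Real.log (2 * (powClass (S := S) G).card / δ)) ≤
      Fintype.card S * Real.sqrt (T * a * Real.log (2 * G.card / δ)) := by
  have hS : 0 < Fintype.card S := Fintype.card_pos
  have h1 : (1 : ℝ) ≤ (powClass (S := S) G).card := by exact_mod_cast Finset.card_pos.2 hG
  have h2 : ((powClass (S := S) G).card : ℝ) ≤ (G.card : ℝ) ^ Fintype.card S := by
    exact_mod_cast card_powClass_le (S := S) G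
  have h3 : Real.log (2 * (powClass (S := S) G).card / δ) ≤
      Fintype.card S * Real.log (2 * G.card / δ) := by
    rw [← Real.log_pow]
    refine Real.log_le_log (by positivity) ?_
    rw [mul_div_right_comm, mul_div_right_comm, mul_pow]
    have h4 : 1 ≤ 2 / δ := by rw [le_div_iff₀ hδ]; linarith
    gcongr
    exact le_self_pow₀ h4 hS.ne'
  have h5 : (Fintype.card S : ℝ) = Real.sqrt ((Fintype.card S : ℝ) ^ 2) :=
    (Real.sqrt_sq (by positivity)).symm
  rw [h5, ← Real.sqrt_mul (by positivity)]
  refine Real.sqrt_le_sqrt ?_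
  rw [← h5]
  calc _ ≤ (T : ℝ) * Fintype.card S * a * (Fintype.card S * Real.log (2 * G.card / δ)) := by gcongr
    _ = _ := by ring

/-- After the initial rounds, the cost of these rounds is absorbed. -/
theorem regret_rate_absorb {n s a T H : ℕ} {p δ : ℝ} (hn : 1 ≤ n) (hs : 1 ≤ s) (hp : 0 < p)
    (hδ : 0 < δ) (hδ1 : δ < 1) (haT : a < T) :
    44 * (1 + Real.log T) ^ 2 *
        ((1 / p + H) * Real.sqrt (T * s * a * Real.log (2 * n / δ)) + a * H) ≤
      132 * (1 + Real.log T) ^ 2 *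
        ((1 / p + H) * Real.sqrt (T * s * a * Real.log (2 * n / δ))) := by
  have hl := half_le_log_two_mul hn hδ hδ1
  have hs' : (1 : ℝ) ≤ s := by exact_mod_cast hs
  have haT' : (a : ℝ) ≤ T := by exact_mod_cast haT.le
  set R := Real.sqrt (T * s * a * Real.log (2 * n / δ)) with hR
  -- Holds because `a ≤ T`, `s ≥ 1` and the logarithm is at least 1/2; hence the new constant `132 =
  -- 44 · (1 + 2)`.
  have h1 : (a : ℝ) ≤ 2 * R := by
    have : (a : ℝ) / 2 ≤ R := by
      refine Real.le_sqrt_of_sq_le ?_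
      calc ((a : ℝ) / 2) ^ 2 ≤ a * a * (1 / 2) := by nlinarith [sq_nonneg (a : ℝ)]
        _ ≤ (T * s) * a * Real.log (2 * n / δ) := by
          gcongr
          nlinarith
    linarith
  have h2 : (a : ℝ) * H ≤ 2 * ((1 / p + H) * R) := by
    have h3 : 0 ≤ 1 / p * R := by positivity
    have h4 := mul_le_mul_of_nonneg_right h1 (Nat.cast_nonneg H : (0 : ℝ) ≤ H)
    nlinarith
  have h5 : 0 ≤ 44 * (1 + Real.log T) ^ 2 := by positivity
  nlinarith

theorem le_measure_setOf_le_mono {Ω : Type*} [MeasurableSpace Ω] {μ : Measure Ω} {f : Ω → ℝ}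
    {x y : ℝ} {e : ENNReal} (h : e ≤ μ {ω | f ω ≤ x}) (hxy : x ≤ y) : e ≤ μ {ω | f ω ≤ y} :=
  h.trans (measure_mono fun _ hω => le_trans hω hxy)

end CMDP

theorem mainTheorem1 :
    ∃ (K : ℝ) (k : ℕ), 0 < K ∧
      (∀ (C : Type u) (S : Type v) (A : Type w) [Fintype C] [Fintype S] [Fintype A]
        [MeasurableSpace C] [DiscreteMeasurableSpace C] [MeasurableSpace S]
        [DiscreteMeasurableSpace S] [MeasurableSpace A] [DiscreteMeasurableSpace A]
        (H : ℕ) (M : LayeredCMDP C S A H) (p : ℝ) (F : Finset (C → S → A → ℝ)) (δ : ℝ) (T : ℕ)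
        (πs : C → S → A)
        (alg : RMKD M F (beta F.card (Fintype.card S) (Fintype.card A) δ)),
        0 < p → p ≤ 1 → M.MinReach p →
        (∀ f ∈ F, ∀ c s a, f c s a ∈ Set.Icc (0 : ℝ) 1) → M.Realizable F →
        0 < δ → δ < 1 → 1 ≤ T → M.IsOptimal πs →
        ENNReal.ofReal (1 - δ) ≤ M.histLaw alg.policy T {hist | M.regret πs alg.policy hist ≤
          K * (1 + Real.log T) ^ k *
            ((1 / p + H) * Real.sqrt (T * Fintype.card S * Fintype.card A *
              Real.log (2 * F.card / δ)) + Fintype.card A * H)} ∧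
        (Fintype.card A < T →
          ENNReal.ofReal (1 - δ) ≤ M.histLaw alg.policy T {hist | M.regret πs alg.policy hist ≤
            K * (1 + Real.log T) ^ k *
              ((1 / p + H) * Real.sqrt (T * Fintype.card S * Fintype.card A *
                Real.log (2 * F.card / δ)))})) ∧
      (∀ (C : Type u) (S : Type v) (A : Type w) [Fintype C] [Fintype S] [Fintype A]
        [MeasurableSpace C] [DiscreteMeasurableSpace C] [MeasurableSpace S]
        [DiscreteMeasurableSpace S] [MeasurableSpace A] [DiscreteMeasurableSpace A]
        (H : ℕ) (M : LayeredCMDP C S A H) (p : ℝ) (G : Finset (C → A → ℝ)) (δ : ℝ) (T : ℕ)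
        (πs : C → S → A)
        (alg : RMKD M (powClass G)
          (beta (powClass (S := S) G).card (Fintype.card S) (Fintype.card A) δ)),
        0 < p → p ≤ 1 → M.MinReach p →
        (∀ g ∈ G, ∀ c a, g c a ∈ Set.Icc (0 : ℝ) 1) → M.Realizable (powClass G) →
        0 < δ → δ < 1 → 1 ≤ T → M.IsOptimal πs →
        ENNReal.ofReal (1 - δ) ≤ M.histLaw alg.policy T {hist | M.regret πs alg.policy hist ≤
          K * (1 + Real.log T) ^ k *
            ((1 / p + H) * Fintype.card S * Real.sqrt (T * Fintype.card A *
              Real.log (2 * G.card / δ)) + Fintype.card A * H)} ∧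
        (Fintype.card A < T →
          ENNReal.ofReal (1 - δ) ≤ M.histLaw alg.policy T {hist | M.regret πs alg.policy hist ≤
            K * (1 + Real.log T) ^ k *
              ((1 / p + H) * Fintype.card S * Real.sqrt (T * Fintype.card A *
                Real.log (2 * G.card / δ)))})) := by
  refine ⟨132, 2, by norm_num, ?_, ?_⟩
  · intro C S A _ _ _ _ _ _ _ _ _ H M p F δ T πs alg hp hp1 hM hF hreal hδ hδ1 hT hπs
    have h := alg.regret_bound hp hM hF hreal hδ hδ1 hT hπs
    have hn : 1 ≤ F.card := by
      obtain ⟨g, hg, -⟩ := hreal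
      exact Finset.card_pos.2 ⟨g, hg⟩
    have hS : 1 ≤ Fintype.card S := Fintype.card_pos_iff.2 ⟨M.s₀⟩
    refine ⟨le_measure_setOf_le_mono h ?_, fun hAT => le_measure_setOf_le_mono h ?_⟩
    · gcongr
      norm_num
    · exact regret_rate_absorb hn hS hp hδ hδ1 hAT
  · intro C S A _ _ _ _ _ _ _ _ _ H M p G δ T πs alg hp hp1 hM hG hreal hδ hδ1 hT hπs
    have h := alg.regret_bound hp hM (powClass_mem_Icc hG) hreal hδ hδ1 hT hπs
    have hne : (powClass (S := S) G).Nonempty := by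
      obtain ⟨g, hg, -⟩ := hreal
      exact ⟨g, hg⟩
    have : Nonempty S := ⟨M.s₀⟩
    have hR := mul_le_mul_of_nonneg_left (sqrt_log_powClass_le hne hδ hδ1 T (Fintype.card A))
      (show (0 : ℝ) ≤ 1 / p + H by positivity)
    rw [← mul_assoc] at hR
    refine ⟨le_measure_setOf_le_mono h ?_, fun hAT => le_measure_setOf_le_mono h ?_⟩
    · gcongr
      norm_num
    · refine (regret_rate_absorb (Finset.card_pos.2 hne) Fintype.card_pos hp hδ hδ1 hAT).trans ?_
      gcongr
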